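/- Let $\mathrm{Sym}_{\mathbb C}$ be the algebra of symmetric functions with complex coefficients, that is, of sequences $(f_N)$ of symmetric polynomials $f_N\in\mathbb C[x_1,\dots,x_N]$ of bounded degree with $f_{N+1}(x_1,\dots,x_N,0)=f_N(x_1,\dots,x_N)$ for all $N$. For a Young diagram $\nu$ let $S_\nu\in\mathrm{Sym}_{\mathbb C}$ be the Schur function, whose $N$-variable component is $\det[x_j^{\nu_i+N-i}]_{i,j=1}^N/\prod_{1\le i<j\le N}(x_i-x_j)$ if $\nu$ has at most $N$ rows and $0$ otherwise, and let $h_n$ ($n\ge 1$) be the complete homogeneous symmetric functions, $h_0=1$. The map $\mathbb C[h_1,h_2,\dots]\to\mathrm{Sym}_{\mathbb C}$ from the algebra of polynomials in formal variables $h_1,h_2,\dots$ to $\mathrm{Sym}_{\mathbb C}$ is an isomorphism; identify the two algebras by it. For $z,z'\in\mathbb C$ the Laguerre operator $\mathcal D:\mathrm{Sym}_{\mathbb C}\to\mathrm{Sym}_{\mathbb C}$ with parameters $z,z'$ is the linear operator which is (well and uniquely) defined by $$\mathcal D S_\nu=-|\nu|\,S_\nu+\sum_{\square}(z+c(\square))(z'+c(\square))\,S_{\nu\setminus\square}\qquad\text{for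 all Young diagrams }\nu,$$ where $\square$ ranges over the corner boxes of $\nu$ (the boxes whose removal leaves a Young diagram) and $c(\square)=j-i$ for the box $\square$ in row $i$ and column $j$. Then, for all $z,z'\in\mathbb C$, the Laguerre operator is the second order differential operator in the variables $h_1,h_2,\dots$ $$\begin{aligned} \mathcal D&=\sum_{n\ge1}\left(\sum_{k=0}^{n-1}(2n-1-2k)\,h_{2n-1-k}h_k\right)\frac{\partial^2}{\partial h_n^2}\\ &\quad+2\sum_{m>n\ge1}\left(\sum_{k=0}^{n-1}(m+n-1-2k)\,h_{m+n-1-k}h_k\right)\frac{\partial^2}{\partial h_m\,\partial h_n}\\ &\quad+\sum_{n\ge1}\big(-n\,h_n+(z+n-1)(z'+n-1)\,h_{n-1}\big)\frac{\partial}{\partial h_n}. \end{aligned}$$ -/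

import Mathlib

open MvPolynomial

namespace SymFun

/-! ### The algebra of symmetric functions -/

/-- The specialization `x_N ↦ 0` of the last variable, from polynomials in `N + 1` variables
to polynomials in `N` variables. -/
noncomputable def restrictLast (N : ℕ) :
    MvPolynomial (Fin (N + 1)) ℂ →ₐ[ℂ] MvPolynomial (Fin N) ℂ :=
  aeval (Fin.snoc (α := fun _ => MvPolynomial (Fin N) ℂ) X 0)

theorem restrictLast_castSucc (N : ℕ) (i : Fin N) :
    restrictLast N (X i.castSucc) = X i := by
  simp [restrictLast]

theorem restrictLast_last (N : ℕ) : restrictLast N (X (Fin.last N)) = 0 := by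
  simp [restrictLast]

/-- The algebra of symmetric functions with complex coefficients: sequences `(f_N)` of symmetric
polynomials `f_N` in `N` variables, compatible with the specializations of the last variable
to `0`, and of bounded degree. -/
noncomputable def SymC : Subalgebra ℂ (∀ N : ℕ, MvPolynomial (Fin N) ℂ) where
  carrier := {f | (∀ N, (f N).IsSymmetric) ∧ (∀ N, restrictLast N (f (N + 1)) = f N) ∧
    ∃ d : ℕ, ∀ N, (f N).totalDegree ≤ d}
  mul_mem' := by
    rintro f g ⟨hf, hf', d, hd⟩ ⟨hg, hg', e, he⟩
    refine ⟨fun N => (hf N).mul (hg N), fun N => ?_, d + e, fun N => ?_⟩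
    · simp [hf', hg']
    · exact (totalDegree_mul _ _).trans (add_le_add (hd N) (he N))
  add_mem' := by
    rintro f g ⟨hf, hf', d, hd⟩ ⟨hg, hg', e, he⟩
    refine ⟨fun N => (hf N).add (hg N), fun N => ?_, max d e, fun N => ?_⟩
    · simp [hf', hg']
    · exact (totalDegree_add _ _).trans (max_le_max (hd N) (he N))
  algebraMap_mem' := by
    intro r
    refine ⟨fun N => IsSymmetric.C r, fun N => ?_, 0, fun N => ?_⟩
    · exact (restrictLast N).commutes r
    · exact (totalDegree_C r).le

/-! ### Complete homogeneous symmetric functions -/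

theorem restrictLast_hsymm (N k : ℕ) :
    restrictLast N (hsymm (Fin (N + 1)) ℂ k) = hsymm (Fin N) ℂ k := by
  classical
  rw [hsymm, hsymm, map_sum]
  symm
  refine Finset.sum_of_injOn (fun s => s.map Fin.castSucc) ?_ ?_ ?_ ?_
  · intro s _ t _ h
    exact Sym.map_injective (Fin.castSucc_injective N) k h
  · intro s _
    simp
  · intro s _ hs
    have hmem : Fin.last N ∈ s.1 := by
      by_contra hcon
      apply hs
      have hlift : ∀ i ∈ s.1, ∃ j : Fin N, j.castSucc = i := by
        intro i hi
        have hne : i ≠ Fin.last N := fun h => hcon (h ▸ hi)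
        exact ⟨i.castPred hne, Fin.castSucc_castPred i hne⟩
      have : CanLift (Fin (N + 1)) (Fin N) Fin.castSucc
        (fun i => ∃ j : Fin N, j.castSucc = i) := ⟨fun _ hx => hx⟩
      obtain ⟨t, ht⟩ := (Multiset.canLift (Fin.castSucc (n := N))
        (fun i => ∃ j : Fin N, j.castSucc = i)).prf s.1 hlift
      refine ⟨⟨t, ?_⟩, Finset.mem_coe.2 (Finset.mem_univ _), ?_⟩
      · rw [← s.2, ← ht, Multiset.card_map]
      · exact Subtype.ext ht
    rw [map_multiset_prod, Multiset.map_map]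
    refine Multiset.prod_eq_zero (Multiset.mem_map.2 ⟨_, hmem, ?_⟩)
    simp [restrictLast_last]
  · intro s _
    rw [map_multiset_prod, Multiset.map_map]
    change _ = (((s.1.map Fin.castSucc)).map _).prod
    rw [Multiset.map_map]
    congr 1
    refine Multiset.map_congr rfl fun i _ => ?_
    simp [restrictLast_castSucc]

theorem totalDegree_hsymm_le (N k : ℕ) : (hsymm (Fin N) ℂ k).totalDegree ≤ k := by
  rw [hsymm]
  refine totalDegree_finsetSum_le fun s _ => ?_
  refine (totalDegree_multiset_prod _).trans ?_
  rw [Multiset.map_map]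
  simp [Function.comp_def, totalDegree_X]

/-- The complete homogeneous symmetric function `h_k`, with `h_0 = 1`. -/
noncomputable def h (k : ℕ) : SymC :=
  ⟨fun N => hsymm (Fin N) ℂ k, fun N => hsymm_isSymmetric (Fin N) ℂ k,
    fun N => restrictLast_hsymm N k, k, fun N => totalDegree_hsymm_le N k⟩

/-! ### Schur functions -/

/-- The Vandermonde product `∏_{i < j} (x_i - x_j)` in `N` variables. -/
noncomputable def vandermonde (N : ℕ) : MvPolynomial (Fin N) ℂ :=
  ∏ i : Fin N, ∏ j ∈ Finset.Ioi i, (X i - X j)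

/-- The alternant `det [x_j ^ (ν_i + N - i)]`; with rows numbered from `0`, the exponent in
row `i` is `ν_i + (N - 1 - i)`. -/
noncomputable def alternant (ν : YoungDiagram) (N : ℕ) : MvPolynomial (Fin N) ℂ :=
  Matrix.det (Matrix.of fun i j : Fin N =>
    (X j : MvPolynomial (Fin N) ℂ) ^ (ν.rowLen i + (N - 1 - (i : ℕ))))

theorem vandermonde_eq_det (N : ℕ) :
    vandermonde N = (Matrix.vandermonde fun i : Fin N => -(X i : MvPolynomial (Fin N) ℂ)).det := by
  rw [Matrix.det_vandermonde, vandermonde]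
  refine Finset.prod_congr rfl fun i _ => Finset.prod_congr rfl fun j _ => ?_
  ring

theorem vandermonde_ne_zero (N : ℕ) : vandermonde N ≠ 0 := by
  rw [vandermonde_eq_det, Matrix.det_vandermonde_ne_zero_iff]
  intro i j hij
  exact X_injective (neg_injective hij)

theorem X_sub_X_irreducible {N : ℕ} {i j : Fin N} (hij : i ≠ j) :
    Irreducible (X i - X j : MvPolynomial (Fin N) ℂ) := by
  have := irreducible_mul_X_add (R := ℂ) (1 : MvPolynomial (Fin N) ℂ) (-X j) i one_ne_zero
    (by simp) (by simpa [vars_neg, vars_X] using hij) (by exact isRelPrime_one_left)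
  simpa [sub_eq_add_neg] using this

theorem X_sub_X_dvd_alternant (ν : YoungDiagram) {N : ℕ} {i j : Fin N} (hij : i ≠ j) :
    (X i - X j : MvPolynomial (Fin N) ℂ) ∣ alternant ν N := by
  rw [← Ideal.mem_span_singleton, ← Ideal.Quotient.eq_zero_iff_mem, alternant, RingHom.map_det]
  refine Matrix.det_zero_of_column_eq hij fun k => ?_
  have hX : Ideal.Quotient.mk (Ideal.span {(X i - X j : MvPolynomial (Fin N) ℂ)}) (X i)
      = Ideal.Quotient.mk _ (X j) :=
    Ideal.Quotient.eq.2 (Ideal.mem_span_singleton_self _)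
  simp [hX]

theorem vandermonde_dvd_alternant (ν : YoungDiagram) (N : ℕ) :
    vandermonde N ∣ alternant ν N := by
  classical
  rw [vandermonde, Finset.prod_sigma']
  refine Finset.prod_dvd_of_isRelPrime ?_ ?_
  · rintro ⟨i, j⟩ hij ⟨k, l⟩ hkl hne
    simp only [Finset.coe_sigma, Set.mem_sigma_iff, Finset.coe_univ, Set.mem_univ, true_and,
      Finset.mem_coe, Finset.mem_Ioi] at hij hkl
    refine (X_sub_X_irreducible hij.ne).isRelPrime_iff_not_dvd.2 ?_
    rintro ⟨q, hq⟩
    have he := congrArg (eval fun t : Fin N => if t = i ∨ t = j then (0 : ℂ) else (t : ℕ) + 1) hq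
    simp only [map_sub, eval_X, map_mul, true_or, or_true, if_true, sub_self, zero_mul,
      sub_eq_zero] at he
    have hpos : ∀ t : ℕ, (t : ℂ) + 1 ≠ 0 := fun t => Nat.cast_add_one_ne_zero t
    by_cases h1 : k = i ∨ k = j <;> by_cases h2 : l = i ∨ l = j
    · apply hne
      rcases h1 with rfl | rfl <;> rcases h2 with rfl | rfl
      · exact absurd hkl (lt_irrefl _)
      · rfl
      · exact absurd hkl hij.asymm
      · exact absurd hkl (lt_irrefl _)
    · rw [if_pos h1, if_neg h2] at he
      exact hpos _ he.symm
    · rw [if_neg h1, if_pos h2] at he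
      exact hpos _ he
    · rw [if_neg h1, if_neg h2] at he
      have : (k : ℕ) = l := by exact_mod_cast add_right_cancel he
      exact hkl.ne (Fin.ext this)
  · rintro ⟨i, j⟩ hij
    simp only [Finset.mem_sigma, Finset.mem_univ, true_and, Finset.mem_Ioi] at hij
    exact X_sub_X_dvd_alternant ν hij.ne

/-- The Schur polynomial in `N` variables: the quotient of the alternant by the Vandermonde
product if `ν` has at most `N` rows, and `0` otherwise. -/
noncomputable def schurPoly (ν : YoungDiagram) (N : ℕ) : MvPolynomial (Fin N) ℂ :=
  if ν.colLen 0 ≤ N then Classical.choose (vandermonde_dvd_alternant ν N) else 0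

theorem vandermonde_mul_schurPoly {ν : YoungDiagram} {N : ℕ} (hN : ν.colLen 0 ≤ N) :
    vandermonde N * schurPoly ν N = alternant ν N := by
  rw [schurPoly, if_pos hN]
  exact (Classical.choose_spec (vandermonde_dvd_alternant ν N)).symm

theorem schurPoly_eq_zero {ν : YoungDiagram} {N : ℕ} (hN : ¬ ν.colLen 0 ≤ N) :
    schurPoly ν N = 0 := if_neg hN

theorem rename_vandermonde {N : ℕ} (σ : Equiv.Perm (Fin N)) :
    rename σ (vandermonde N) = ((Equiv.Perm.sign σ : ℤ) : MvPolynomial (Fin N) ℂ)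
      * vandermonde N := by
  rw [vandermonde_eq_det, ← Matrix.det_permute, AlgHom.map_det]
  congr 1
  ext i j : 2
  simp [Matrix.vandermonde_apply]

theorem rename_alternant (ν : YoungDiagram) {N : ℕ} (σ : Equiv.Perm (Fin N)) :
    rename σ (alternant ν N) = ((Equiv.Perm.sign σ : ℤ) : MvPolynomial (Fin N) ℂ)
      * alternant ν N := by
  rw [alternant, ← Matrix.det_permute', AlgHom.map_det]
  congr 1
  ext i j : 2
  simp

theorem schurPoly_isSymmetric (ν : YoungDiagram) (N : ℕ) : (schurPoly ν N).IsSymmetric := by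
  by_cases hN : ν.colLen 0 ≤ N
  · intro σ
    have h1 := congrArg (rename σ) (vandermonde_mul_schurPoly hN)
    rw [map_mul, rename_vandermonde, rename_alternant, ← vandermonde_mul_schurPoly hN,
      mul_assoc] at h1
    refine mul_left_cancel₀ (vandermonde_ne_zero N) (mul_left_cancel₀ ?_ h1)
    rcases Int.units_eq_one_or (Equiv.Perm.sign σ) with h | h <;> simp [h]
  · rw [schurPoly_eq_zero hN]
    exact IsSymmetric.zero

theorem restrictLast_vandermonde (N : ℕ) :
    restrictLast N (vandermonde (N + 1)) = vandermonde N * ∏ i : Fin N, X i := by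
  classical
  have hI : ∀ i : Fin N, Finset.Ioi i.castSucc
      = insert (Fin.last N) ((Finset.Ioi i).map Fin.castSuccEmb) := by
    intro i
    ext j
    refine Fin.lastCases ?_ (fun j => ?_) j
    · simp [Fin.castSucc_lt_last]
    · simp [Fin.le_last]
  rw [vandermonde, map_prod, Fin.prod_univ_castSucc, vandermonde, ← Finset.prod_mul_distrib]
  have hl : Finset.Ioi (Fin.last N) = ∅ := by
    ext j
    simp [Fin.le_last]
  rw [hl, Finset.prod_empty, map_one, mul_one]
  refine Finset.prod_congr rfl fun i _ => ?_
  rw [hI, Finset.prod_insert (by simp), Finset.prod_map, map_mul, map_prod, mul_comm]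
  simp [restrictLast_castSucc, restrictLast_last]

theorem rowLen_eq_zero_iff (ν : YoungDiagram) (i : ℕ) : ν.rowLen i = 0 ↔ ν.colLen 0 ≤ i := by
  rw [← not_iff_not, not_le, ← YoungDiagram.mem_iff_lt_colLen, YoungDiagram.mem_iff_lt_rowLen]
  omega

theorem restrictLast_alternant_of_le {ν : YoungDiagram} {N : ℕ} (hN : ν.colLen 0 ≤ N) :
    restrictLast N (alternant ν (N + 1)) = alternant ν N * ∏ i : Fin N, X i := by
  rw [alternant, AlgHom.map_det, Matrix.det_succ_column _ (Fin.last N),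
    Finset.sum_eq_single (Fin.last N)]
  · have h0 : ν.rowLen N = 0 := (rowLen_eq_zero_iff ν N).2 hN
    have hM : (((restrictLast N).mapMatrix (Matrix.of fun i j : Fin (N + 1) =>
        (X j : MvPolynomial (Fin (N + 1)) ℂ) ^ (ν.rowLen i + (N + 1 - 1 - (i : ℕ))))).submatrix
          (Fin.last N).succAbove (Fin.last N).succAbove)
        = Matrix.of fun i j : Fin N => X j * (Matrix.of fun i j : Fin N =>
          (X j : MvPolynomial (Fin N) ℂ) ^ (ν.rowLen i + (N - 1 - (i : ℕ)))) i j := by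
      ext i j : 2
      have : ν.rowLen i + (N - i) = (ν.rowLen i + (N - 1 - i)) + 1 := by omega
      simp [restrictLast_castSucc, this, pow_succ']
    rw [hM, Matrix.det_mul_row, alternant]
    simp [h0, mul_comm]
  · intro i _ hi
    have hlt : (i : ℕ) < N := Fin.val_lt_last hi
    have h1 : N - (i : ℕ) ≠ 0 := by omega
    simp [restrictLast_last, h1]
  · simp

theorem restrictLast_alternant_of_lt {ν : YoungDiagram} {N : ℕ} (hN : N < ν.colLen 0) :
    restrictLast N (alternant ν (N + 1)) = 0 := by
  rw [alternant, AlgHom.map_det]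
  refine Matrix.det_eq_zero_of_column_eq_zero (Fin.last N) fun i => ?_
  have h1 : ν.rowLen i = 0 → ¬ N - (i : ℕ) = 0 := by
    rw [rowLen_eq_zero_iff]
    omega
  simpa [restrictLast_last] using h1

theorem restrictLast_schurPoly (ν : YoungDiagram) (N : ℕ) :
    restrictLast N (schurPoly ν (N + 1)) = schurPoly ν N := by
  have hp : (∏ i : Fin N, X i : MvPolynomial (Fin N) ℂ) ≠ 0 :=
    Finset.prod_ne_zero_iff.2 fun i _ => X_ne_zero i
  have hV := mul_ne_zero (vandermonde_ne_zero N) hp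
  by_cases h1 : ν.colLen 0 ≤ N + 1
  · have h := congrArg (restrictLast N) (vandermonde_mul_schurPoly h1)
    rw [map_mul, restrictLast_vandermonde] at h
    by_cases h2 : ν.colLen 0 ≤ N
    · rw [restrictLast_alternant_of_le h2, ← vandermonde_mul_schurPoly h2] at h
      refine mul_left_cancel₀ hV ?_
      rw [h]
      ring
    · rw [restrictLast_alternant_of_lt (not_le.1 h2)] at h
      rw [schurPoly_eq_zero h2]
      exact (mul_eq_zero.1 h).resolve_left hV
  · rw [schurPoly_eq_zero h1, schurPoly_eq_zero (by omega), map_zero]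

theorem vandermonde_isHomogeneous (N : ℕ) :
    (vandermonde N).IsHomogeneous (∑ i : Fin N, (N - 1 - (i : ℕ))) := by
  refine IsHomogeneous.prod _ _ _ fun i _ => ?_
  have := IsHomogeneous.prod (Finset.Ioi i)
    (fun j => (X i - X j : MvPolynomial (Fin N) ℂ)) (fun _ => 1)
    fun j _ => (isHomogeneous_X ℂ i).sub (isHomogeneous_X ℂ j)
  simpa using this

theorem alternant_isHomogeneous (ν : YoungDiagram) (N : ℕ) :
    (alternant ν N).IsHomogeneous (∑ i : Fin N, (ν.rowLen i + (N - 1 - (i : ℕ)))) := by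
  rw [alternant, ← Matrix.det_transpose, Matrix.det_apply']
  refine IsHomogeneous.sum _ _ _ fun σ _ => ?_
  have h1 : (((Equiv.Perm.sign σ : ℤ) : MvPolynomial (Fin N) ℂ)).IsHomogeneous 0 := by
    have := isHomogeneous_C (Fin N) (((Equiv.Perm.sign σ : ℤ) : ℂ))
    simpa using this
  have h2 : (∏ i, (Matrix.of fun i j : Fin N =>
      (X j : MvPolynomial (Fin N) ℂ) ^ (ν.rowLen i + (N - 1 - (i : ℕ)))).transpose
        (σ i) i).IsHomogeneous (∑ i : Fin N, (ν.rowLen i + (N - 1 - (i : ℕ)))) := by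
    refine IsHomogeneous.prod _ _ _ fun i _ => ?_
    exact isHomogeneous_X_pow _ _
  simpa using h1.mul h2

theorem totalDegree_schurPoly_le (ν : YoungDiagram) (N : ℕ) :
    (schurPoly ν N).totalDegree ≤ ∑ i ∈ Finset.range (ν.colLen 0), ν.rowLen i := by
  by_cases hN : ν.colLen 0 ≤ N
  · by_cases hs : schurPoly ν N = 0
    · simp [hs]
    have h1 := totalDegree_mul_of_isDomain (vandermonde_ne_zero N) hs
    rw [vandermonde_mul_schurPoly hN,
      (vandermonde_isHomogeneous N).totalDegree (vandermonde_ne_zero N)] at h1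
    have h2 := (alternant_isHomogeneous ν N).totalDegree_le
    rw [Finset.sum_add_distrib] at h2
    have h3 : ∑ i : Fin N, ν.rowLen i = ∑ i ∈ Finset.range (ν.colLen 0), ν.rowLen i := by
      rw [Fin.sum_univ_eq_sum_range (fun i => ν.rowLen i)]
      refine (Finset.sum_subset (by simpa using hN) fun i _ hi => ?_).symm
      rw [rowLen_eq_zero_iff]
      simpa using hi
    omega
  · simp [schurPoly_eq_zero hN]

/-- The Schur function `S_ν`, whose image in `N` variables is the Schur polynomial. -/
noncomputable def schur (ν : YoungDiagram) : SymC :=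
  ⟨fun N => schurPoly ν N, schurPoly_isSymmetric ν, restrictLast_schurPoly ν,
    _, totalDegree_schurPoly_le ν⟩

/-! ### The Laguerre operator -/

/-- The content `j - i` of the box in row `i` and column `j`. -/
def content (c : ℕ × ℕ) : ℂ := (c.2 : ℂ) - (c.1 : ℂ)

open scoped Classical in
/-- The corner boxes of `ν`: the boxes whose removal leaves a Young diagram. -/
noncomputable def corners (ν : YoungDiagram) : Finset (ℕ × ℕ) :=
  {c ∈ ν.cells | IsLowerSet (ν.cells.erase c : Set (ℕ × ℕ))}

theorem mem_corners {ν : YoungDiagram} {c : ℕ × ℕ} :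
    c ∈ corners ν ↔ c ∈ ν.cells ∧ IsLowerSet (ν.cells.erase c : Set (ℕ × ℕ)) := by
  classical
  simp only [corners, Finset.mem_filter]

/-- The Young diagram obtained from `ν` by removing a corner box. -/
noncomputable def removeCorner (ν : YoungDiagram) (c : {c // c ∈ corners ν}) : YoungDiagram where
  cells := ν.cells.erase c
  isLowerSet := (mem_corners.1 c.2).2

/-- `D` is the Laguerre operator with parameters `z, z'`:
`D S_ν = -|ν| S_ν + ∑_{□} (z + c(□)) (z' + c(□)) S_{ν ∖ □}` for all `ν`, the sum being over
the corner boxes of `ν`. -/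
def IsLaguerreOperator (z z' : ℂ) (D : SymC →ₗ[ℂ] SymC) : Prop :=
  ∀ ν : YoungDiagram, D (schur ν) = -(ν.card : ℂ) • schur ν +
    ∑ c ∈ (corners ν).attach,
      ((z + content c) * (z' + content c)) • schur (removeCorner ν c)

/-! ### Differential operators in the variables `h_1, h_2, …` -/

/-- The algebra homomorphism `ℂ[h_1, h_2, …] → Sym` sending the variable with index `n` to the
complete homogeneous symmetric function `h_n`. -/
noncomputable def evalH : MvPolynomial ℕ+ ℂ →ₐ[ℂ] SymC := aeval fun n : ℕ+ => h n

/-- The formal variable `h_n` for `n ≥ 1`, and `1` for `n = 0`. -/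
noncomputable def hVar (n : ℕ) : MvPolynomial ℕ+ ℂ :=
  if hn : 0 < n then X ⟨n, hn⟩ else 1

/-- The coefficient `∑_{k=0}^{n-1} (m + n - 1 - 2k) h_{m+n-1-k} h_k`, used for `m ≥ n`. -/
noncomputable def coeff₂ (m n : ℕ+) : MvPolynomial ℕ+ ℂ :=
  ∑ k ∈ Finset.range n,
    C ((m : ℂ) + (n : ℂ) - 1 - 2 * (k : ℂ)) * (hVar ((m : ℕ) + n - 1 - k) * hVar k)

/-- The coefficient `-n h_n + (z + n - 1) (z' + n - 1) h_{n-1}`. -/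
noncomputable def coeff₁ (z z' : ℂ) (n : ℕ+) : MvPolynomial ℕ+ ℂ :=
  -(C (n : ℂ) * hVar n) + C ((z + (n : ℂ) - 1) * (z' + (n : ℂ) - 1)) * hVar ((n : ℕ) - 1)

/-- The formal second order differential operator. The sums are infinite, but only finitely many
terms are nonzero on a given polynomial. -/
noncomputable def diffOp (z z' : ℂ) (F : MvPolynomial ℕ+ ℂ) : MvPolynomial ℕ+ ℂ :=
  ∑ᶠ n : ℕ+, coeff₂ n n * pderiv n (pderiv n F)
  + 2 * ∑ᶠ p : {p : ℕ+ × ℕ+ // p.2 < p.1},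
      coeff₂ p.1.1 p.1.2 * pderiv p.1.1 (pderiv p.1.2 F)
  + ∑ᶠ n : ℕ+, coeff₁ z z' n * pderiv n F

theorem finite_pderiv_ne_zero (F : MvPolynomial ℕ+ ℂ) : {n : ℕ+ | pderiv n F ≠ 0}.Finite := by
  refine F.vars.finite_toSet.subset fun n hn => ?_
  by_contra h
  exact hn (pderiv_eq_zero_of_notMem_vars h)

theorem diffOp_support_diag (F : MvPolynomial ℕ+ ℂ) :
    (Function.support fun n : ℕ+ => coeff₂ n n * pderiv n (pderiv n F)).Finite := by
  refine (finite_pderiv_ne_zero F).subset fun n hn h0 => hn ?_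
  simp [h0]

theorem diffOp_support_offDiag (F : MvPolynomial ℕ+ ℂ) :
    (Function.support fun p : {p : ℕ+ × ℕ+ // p.2 < p.1} =>
      coeff₂ p.1.1 p.1.2 * pderiv p.1.1 (pderiv p.1.2 F)).Finite := by
  refine Set.Finite.of_finite_image (f := Subtype.val) ?_ Subtype.val_injective.injOn
  refine ((finite_pderiv_ne_zero F).biUnion fun n _ =>
    (finite_pderiv_ne_zero (pderiv n F)).image fun m => (m, n)).subset ?_
  rintro _ ⟨⟨⟨m, n⟩, hmn⟩, hp, rfl⟩
  simp only [Set.mem_iUnion, Set.mem_image, Set.mem_ofPred_eq]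
  refine ⟨n, fun h0 => hp ?_, m, fun h0 => hp ?_, rfl⟩ <;> simp [h0]

theorem diffOp_support_first (z z' : ℂ) (F : MvPolynomial ℕ+ ℂ) :
    (Function.support fun n : ℕ+ => coeff₁ z z' n * pderiv n F).Finite := by
  refine (finite_pderiv_ne_zero F).subset fun n hn h0 => hn ?_
  simp [h0]

end SymFun

open MvPolynomial

namespace SymFun

/-! ### The symbol of the second order part -/

/-! By Jacobi–Trudi, `S_ν = det[h_{b_i + c}]` with `b_i = ν_i - i`, rows and columns numbered from
0. So it suffices to compute the differential operator `D` on such determinants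
(`diffOp_det_jtMatrix`) and to know that the `h_n` generate freely and that the Schur functions
span.

A second order operator acts on a product by acting on each single factor and by pairing the factors
two at a time through its symbol. The symbol `S(m, n)` is symmetric and satisfies `S(m, n+1) =
S(m+1, n) + (m - n) h_m h_n` for all integers, once extended by zero. Inside a determinant only the
part of a pair term antisymmetric in the rows survives. Shifting the recurrence from columns `(c,
d)` to `(d, c)` therefore determines the pair term, and nearly all its pieces are determinants with
equal columns (`pairSum_symbolInt_of_lt`). In total, column `d` contributes `-2d` times the
determinant whose column `d` has become `(b_i + d - 1) h_{b_i + d - 1}`.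

The first order coefficient splits as `(z + b + c - 1)(z' + b + c - 1) = (z + b - 1)(z' + b - 1) +
2c(b + c - 1) + c(z + z' - c)`. The middle term cancels the pair contribution and the last one
yields a repeated column. What remains lowers one row index `b_i` by 1, with weight depending only
on `b_i`. As `b_i - 1` is the content of the last box of row `i`, and the lowered determinant
vanishes unless that box is a corner, this is the Laguerre formula.

Spanning comes from expanding Vandermonde times a symmetric polynomial in alternants
(`span_range_schur`). Algebraic independence holds because `h_1, …, h_N` take arbitrary values at
points of `ℂ^N` (`exists_eval_hsymm_eq`). -/

theorem hVar_zero : hVar 0 = 1 := by simp [hVar]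

/-- The variable `h_n` indexed by the integers, with `h_0 = 1` and `h_n = 0` for `n < 0`. -/
noncomputable def hInt (n : ℤ) : MvPolynomial ℕ+ ℂ := if n < 0 then 0 else hVar n.toNat

theorem hInt_of_neg {n : ℤ} (hn : n < 0) : hInt n = 0 := if_pos hn

@[simp] theorem hInt_natCast (n : ℕ) : hInt n = hVar n := by
  simp [hInt]

/-- The sum `∑_{k < n} (m + n - 1 - 2k) h_{m+n-1-k} h_k`. -/
noncomputable def symbolNat (m n : ℕ) : MvPolynomial ℕ+ ℂ :=
  ∑ k ∈ Finset.range n,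
    C ((m : ℂ) + (n : ℂ) - 1 - 2 * (k : ℂ)) * (hVar (m + n - 1 - k) * hVar k)

theorem coeff₂_eq_symbolNat (m n : ℕ+) : coeff₂ m n = symbolNat m n := rfl

/-- The two sums differ by the terms with `m ≤ k < n`. These change sign under `k ↦ m + n - 1 - k`,
so they cancel. -/
theorem symbolNat_comm_of_le {m n : ℕ} (hmn : m ≤ n) : symbolNat m n = symbolNat n m := by
  rw [symbolNat, symbolNat, ← Finset.sum_range_add_sum_Ico _ hmn]
  have h0 : ∑ k ∈ Finset.Ico m n,
      C ((m : ℂ) + (n : ℂ) - 1 - 2 * (k : ℂ)) * (hVar (m + n - 1 - k) * hVar k) = 0 := by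
    have hrefl := Finset.sum_nbij' (s := Finset.Ico m n) (t := Finset.Ico m n)
      (fun k => m + n - 1 - k) (fun k => m + n - 1 - k)
      (f := fun k => C ((m : ℂ) + (n : ℂ) - 1 - 2 * (k : ℂ)) * (hVar (m + n - 1 - k) * hVar k))
      (g := fun k => -(C ((m : ℂ) + (n : ℂ) - 1 - 2 * (k : ℂ)) *
        (hVar (m + n - 1 - k) * hVar k)))
      (by simp only [Finset.mem_Ico]; intros; omega)
      (by simp only [Finset.mem_Ico]; intros; omega)
      (by simp only [Finset.mem_Ico]; intros; omega)
      (by simp only [Finset.mem_Ico]; intros; omega)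
      (by
        intro k hk
        simp only [Finset.mem_Ico] at hk
        have h1 : m + n - 1 - (m + n - 1 - k) = k := by omega
        have h2 : ((m + n - 1 - k : ℕ) : ℂ) = (m : ℂ) + n - 1 - k := by
          rw [Nat.cast_sub (by omega), Nat.cast_sub (by omega)]
          push_cast
          ring
        simp only [h1, h2]
        rw [mul_comm (hVar k), ← neg_mul, ← map_neg]
        congr 2
        ring)
    rw [Finset.sum_neg_distrib] at hrefl
    exact self_eq_neg.1 hrefl
  rw [h0, add_zero]
  refine Finset.sum_congr rfl fun k _ => ?_
  rw [add_comm (m : ℂ), add_comm m]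

theorem symbolNat_comm (m n : ℕ) : symbolNat m n = symbolNat n m := by
  rcases le_total m n with hmn | hmn
  · exact symbolNat_comm_of_le hmn
  · exact (symbolNat_comm_of_le hmn).symm

theorem symbolNat_zero_right (m : ℕ) : symbolNat m 0 = 0 := by simp [symbolNat]

theorem symbolNat_zero_left (n : ℕ) : symbolNat 0 n = 0 := by
  rw [symbolNat_comm, symbolNat_zero_right]

/-- The summands depend only on `k` and on the total `m + n + 1`, common to both sides; the left sum
has the one extra term `k = n`. -/
theorem symbolNat_succ (m n : ℕ) :
    symbolNat m (n + 1) = symbolNat (m + 1) n + C ((m : ℂ) - n) * (hVar m * hVar n) := by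
  rw [symbolNat, symbolNat, Finset.sum_range_succ]
  congr 1
  · refine Finset.sum_congr rfl fun k _ => ?_
    have h1 : m + (n + 1) - 1 - k = m + 1 + n - 1 - k := by omega
    rw [h1]
    congr 2
    push_cast
    ring
  · have h1 : m + (n + 1) - 1 - n = m := by omega
    rw [h1]
    congr 2
    push_cast
    ring

/-- The extension of `symbolNat` by zero to integral arguments. -/
noncomputable def symbolInt (m n : ℤ) : MvPolynomial ℕ+ ℂ :=
  if 0 ≤ m ∧ 0 ≤ n then symbolNat m.toNat n.toNat else 0

@[simp] theorem symbolInt_natCast (m n : ℕ) : symbolInt m n = symbolNat m n := by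
  simp [symbolInt]

theorem symbolInt_of_nonpos_left {m : ℤ} (hm : m ≤ 0) (n : ℤ) : symbolInt m n = 0 := by
  rw [symbolInt]
  split_ifs with h
  · rw [Int.toNat_of_nonpos hm, symbolNat_zero_left]
  · rfl

theorem symbolInt_comm (m n : ℤ) : symbolInt m n = symbolInt n m := by
  rw [symbolInt, symbolInt, symbolNat_comm]
  simp only [and_comm]

theorem symbolInt_of_nonpos_right {n : ℤ} (hn : n ≤ 0) (m : ℤ) : symbolInt m n = 0 := by
  rw [symbolInt_comm, symbolInt_of_nonpos_left hn]

/-- Extension by zero preserves the recurrence: if `m` or `n` is negative, then `h_m h_n = 0` and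
both symbols have a nonpositive argument. -/
theorem symbolInt_add_one (m n : ℤ) :
    symbolInt m (n + 1) = symbolInt (m + 1) n + C ((m : ℂ) - n) * (hInt m * hInt n) := by
  rcases lt_or_ge m 0 with hm | hm
  · rw [hInt_of_neg hm, symbolInt_of_nonpos_left hm.le, symbolInt_of_nonpos_left (by omega)]
    simp
  rcases lt_or_ge n 0 with hn | hn
  · rw [hInt_of_neg hn, symbolInt_of_nonpos_right hn.le, symbolInt_of_nonpos_right (by omega)]
    simp
  lift m to ℕ using hm
  lift n to ℕ using hn
  have := symbolNat_succ m n
  rw [← Nat.cast_add_one, ← Nat.cast_add_one, symbolInt_natCast, symbolInt_natCast, this]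
  simp

/-! ### The operator on products -/

/-- The commutator of two derivations is a derivation, and this one kills every variable. -/
theorem pderiv_pderiv_comm {σ : Type*} (m n : σ) (F : MvPolynomial σ ℂ) :
    pderiv m (pderiv n F) = pderiv n (pderiv m F) := by
  classical
  have h : ⁅(pderiv m : Derivation ℂ (MvPolynomial σ ℂ) (MvPolynomial σ ℂ)),
      (pderiv n : Derivation ℂ (MvPolynomial σ ℂ) (MvPolynomial σ ℂ))⁆ = 0 := by
    refine derivation_ext fun i => ?_
    have hs : ∀ j k l : σ, pderiv (R := ℂ) k ((Pi.single j 1 : σ → MvPolynomial σ ℂ) l) = 0 := by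
      intro j k l
      rcases eq_or_ne l j with rfl | h
      · simp
      · simp [h]
    rw [Derivation.commutator_apply, pderiv_X, pderiv_X]
    simp [hs]
  have := congrArg (fun D => D F) h
  simpa [Derivation.commutator_apply, sub_eq_zero] using this

theorem derivation_prod {A ι : Type*} [CommRing A] [Algebra ℂ A] [DecidableEq ι]
    (D : Derivation ℂ A A) (s : Finset ι) (f : ι → A) :
    D (∏ i ∈ s, f i) = ∑ i ∈ s, D (f i) * ∏ j ∈ s.erase i, f j := by
  induction s using Finset.induction_on with
  | empty => simp
  | insert a s ha ih =>
    rw [Finset.prod_insert ha, Derivation.leibniz, Finset.sum_insert ha, ih,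
      Finset.erase_insert ha, smul_eq_mul, smul_eq_mul, add_comm, mul_comm, Finset.mul_sum]
    congr 1
    refine Finset.sum_congr rfl fun i hi => ?_
    have hia : i ≠ a := fun h => ha (h ▸ hi)
    rw [Finset.erase_insert_of_ne hia.symm, Finset.prod_insert (by simp [ha])]
    ring

theorem sum_sum_eq_diag_add {ι A : Type*} [LinearOrder ι] [Semiring A] (s : Finset ι)
    (f : ι → ι → A) (hf : ∀ m n, f m n = f n m) :
    ∑ m ∈ s, ∑ n ∈ s, f m n =
      ∑ n ∈ s, f n n + 2 * ∑ p ∈ s ×ˢ s with p.2 < p.1, f p.1 p.2 := by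
  rw [← Finset.sum_product', ← Finset.sum_filter_add_sum_filter_not (s ×ˢ s) (fun p => p.2 < p.1),
    ← Finset.sum_filter_add_sum_filter_not ((s ×ˢ s).filter fun p => ¬ p.2 < p.1)
      (fun p => p.1 < p.2), Finset.filter_filter, Finset.filter_filter, two_mul]
  have h1 : ∑ p ∈ s ×ˢ s with ¬ p.2 < p.1 ∧ p.1 < p.2, f p.1 p.2
      = ∑ p ∈ s ×ˢ s with p.2 < p.1, f p.1 p.2 := by
    refine Finset.sum_nbij' Prod.swap Prod.swap ?_ ?_ ?_ ?_ ?_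
    · simp +contextual
    · simp +contextual [le_of_lt]
    · simp
    · simp
    · intro p _
      exact hf _ _
  have h2 : ∑ p ∈ s ×ˢ s with ¬ p.2 < p.1 ∧ ¬ p.1 < p.2, f p.1 p.2 = ∑ n ∈ s, f n n := by
    refine Finset.sum_nbij' Prod.fst (fun n => (n, n)) ?_ ?_ ?_ ?_ ?_
    · simp +contextual
    · simp
    · rintro ⟨a, b⟩ h
      simp only [Finset.mem_filter, not_lt] at h
      simp [le_antisymm h.2.1 h.2.2]
    · simp
    · rintro ⟨a, b⟩ h
      simp only [Finset.mem_filter, not_lt] at h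
      simp [le_antisymm h.2.1 h.2.2]
  rw [h1, h2, add_comm, add_comm (∑ p ∈ s ×ˢ s with p.2 < p.1, f p.1 p.2), add_assoc]

/-- Symmetry of the coefficients merges the diagonal and the doubled off-diagonal part into one sum
over ordered pairs. Leaving `s` free lets several polynomials share the same index set. -/
theorem diffOp_eq_sum (z z' : ℂ) {F : MvPolynomial ℕ+ ℂ} {s : Finset ℕ+} (hs : F.vars ⊆ s) :
    diffOp z z' F = ∑ m ∈ s, ∑ n ∈ s, coeff₂ m n * pderiv m (pderiv n F)
      + ∑ n ∈ s, coeff₁ z z' n * pderiv n F := by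
  have h0 : ∀ n, n ∉ s → pderiv n F = 0 := fun n hn =>
    pderiv_eq_zero_of_notMem_vars fun h => hn (hs h)
  rw [diffOp, sum_sum_eq_diag_add]
  · congr 1
    · congr 1
      · refine finsum_eq_sum_of_support_subset _ fun n hn => ?_
        by_contra h
        exact hn (by simp [h0 n h])
      · congr 1
        refine (finsum_subtype_eq_finsum_cond (f := fun p : ℕ+ × ℕ+ =>
          coeff₂ p.1 p.2 * pderiv p.1 (pderiv p.2 F)) (fun p => p.2 < p.1)).trans ?_
        refine finsum_cond_eq_sum_of_cond_iff _ fun {p} hp => ?_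
        have h2 : p.2 ∈ s := by
          by_contra h
          exact hp (by simp [h0 _ h])
        have h1 : p.1 ∈ s := by
          by_contra h
          exact hp (by simp [pderiv_pderiv_comm p.1, h0 _ h])
        simp [h1, h2]
    · refine finsum_eq_sum_of_support_subset _ fun n hn => ?_
      by_contra h
      exact hn (by simp [h0 n h])
  · intro m n
    rw [pderiv_pderiv_comm, coeff₂_eq_symbolNat, coeff₂_eq_symbolNat, symbolNat_comm]

theorem diffOp_add (z z' : ℂ) (F G : MvPolynomial ℕ+ ℂ) :
    diffOp z z' (F + G) = diffOp z z' F + diffOp z z' G := by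
  rw [diffOp_eq_sum z z' (vars_add_subset F G),
    diffOp_eq_sum z z' (Finset.subset_union_left (s₁ := F.vars) (s₂ := G.vars)),
    diffOp_eq_sum z z' (Finset.subset_union_right (s₁ := F.vars) (s₂ := G.vars))]
  simp only [map_add, mul_add, Finset.sum_add_distrib]
  abel

theorem diffOp_smul (z z' : ℂ) (a : ℂ) (F : MvPolynomial ℕ+ ℂ) :
    diffOp z z' (a • F) = a • diffOp z z' F := by
  have h : (a • F).vars ⊆ F.vars := by
    rw [smul_eq_C_mul]
    refine (vars_mul _ _).trans ?_
    simp
  rw [diffOp_eq_sum z z' h, diffOp_eq_sum z z' subset_rfl]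
  simp only [Derivation.map_smul, mul_smul_comm, ← Finset.smul_sum, smul_add]

/-- The differential operator `diffOp` as a linear map. -/
noncomputable def diffOpLin (z z' : ℂ) : MvPolynomial ℕ+ ℂ →ₗ[ℂ] MvPolynomial ℕ+ ℂ where
  toFun := diffOp z z'
  map_add' := diffOp_add z z'
  map_smul' := diffOp_smul z z'

@[simp] theorem diffOpLin_apply (z z' : ℂ) (F : MvPolynomial ℕ+ ℂ) :
    diffOpLin z z' F = diffOp z z' F := rfl

theorem diffOp_one (z z' : ℂ) : diffOp z z' 1 = 0 := by
  rw [diffOp_eq_sum z z' (s := ∅) (by simp)]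
  simp

theorem hInt_cases (n : ℤ) : (n < 0 ∧ hInt n = 0) ∨ (n = 0 ∧ hInt n = 1) ∨
    ∃ m : ℕ+, n = m ∧ hInt n = X m := by
  rcases lt_trichotomy n 0 with h | h | h
  · exact Or.inl ⟨h, hInt_of_neg h⟩
  · subst h
    exact Or.inr (Or.inl ⟨rfl, by simpa [hVar_zero] using hInt_natCast 0⟩)
  · lift n to ℕ using h.le
    have hn : 0 < n := by exact_mod_cast h
    exact Or.inr (Or.inr ⟨⟨n, hn⟩, rfl, by simp [hVar, hn]⟩)

/-- The formula persists for `n ≤ 0`: at `n = 0` the factor `n` and `h_{-1}` vanish, and below that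
everything does. -/
theorem diffOp_hInt (z z' : ℂ) (n : ℤ) : diffOp z z' (hInt n) =
    -(C (n : ℂ) * hInt n) + C ((z + n - 1) * (z' + n - 1)) * hInt (n - 1) := by
  rcases hInt_cases n with ⟨hn, h⟩ | ⟨rfl, h⟩ | ⟨m, rfl, h⟩
  · rw [h, hInt_of_neg (show n - 1 < 0 by omega)]
    simpa using (diffOpLin z z').map_zero
  · rw [h, diffOp_one, hInt_of_neg (show (0 : ℤ) - 1 < 0 by omega)]
    simp
  · rw [h, diffOp_eq_sum z z' (s := {m}) (by simp [vars_X])]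
    have h1 : ((m : ℕ) : ℤ) - 1 = ((m - 1 : ℕ) : ℤ) := by
      have := m.pos
      omega
    have h2 : hVar (m : ℕ) = X m := by rw [← h, hInt_natCast]
    rw [h1, hInt_natCast]
    simp [coeff₁, h2]

theorem sum_coeff₂_mul_pderiv_hInt (a b : ℤ) {s : Finset ℕ+} (ha : (hInt a).vars ⊆ s)
    (hb : (hInt b).vars ⊆ s) :
    ∑ m ∈ s, ∑ n ∈ s, coeff₂ m n * (pderiv m (hInt a) * pderiv n (hInt b)) = symbolInt a b := by
  rcases hInt_cases a with ⟨hn, h⟩ | ⟨rfl, h⟩ | ⟨m, rfl, h⟩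
  · simp [h, symbolInt_of_nonpos_left hn.le]
  · simp [h, symbolInt_of_nonpos_left]
  rcases hInt_cases b with ⟨hn, h'⟩ | ⟨rfl, h'⟩ | ⟨n, rfl, h'⟩
  · simp [h', symbolInt_of_nonpos_right hn.le]
  · simp [h', symbolInt_of_nonpos_right]
  rw [h, vars_X, Finset.singleton_subset_iff] at ha
  rw [h', vars_X, Finset.singleton_subset_iff] at hb
  rw [h, h', Finset.sum_eq_single_of_mem m ha, Finset.sum_eq_single_of_mem n hb]
  · simp [coeff₂_eq_symbolNat]
  · intro k _ hk
    simp [pderiv_X_of_ne hk.symm]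
  · intro k _ hk
    simp [pderiv_X_of_ne hk.symm]

/-- Leibniz rule of second order: both derivatives hit the same factor, or they hit two different
ones. The latter case is a sum over ordered pairs, so no factor 2 appears. -/
theorem diffOp_prod_hInt (z z' : ℂ) {ι : Type*} [DecidableEq ι] (t : Finset ι) (a : ι → ℤ) :
    diffOp z z' (∏ i ∈ t, hInt (a i)) =
      ∑ i ∈ t, diffOp z z' (hInt (a i)) * ∏ j ∈ t.erase i, hInt (a j)
      + ∑ i ∈ t, ∑ j ∈ t.erase i,
        symbolInt (a i) (a j) * ∏ k ∈ (t.erase i).erase j, hInt (a k) := by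
  obtain ⟨s, hs₀, hs⟩ : ∃ s : Finset ℕ+, (∏ i ∈ t, hInt (a i)).vars ⊆ s ∧
      ∀ i ∈ t, (hInt (a i)).vars ⊆ s :=
    ⟨(∏ i ∈ t, hInt (a i)).vars ∪ t.biUnion fun i => (hInt (a i)).vars,
      Finset.subset_union_left, fun i hi =>
      (Finset.subset_biUnion_of_mem (fun i => (hInt (a i)).vars) hi).trans
        Finset.subset_union_right⟩
  have h2 : ∀ m n : ℕ+, pderiv m (pderiv n (∏ i ∈ t, hInt (a i))) =
      ∑ i ∈ t, pderiv m (pderiv n (hInt (a i))) * ∏ j ∈ t.erase i, hInt (a j)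
      + ∑ i ∈ t, ∑ j ∈ t.erase i, (pderiv n (hInt (a i)) * pderiv m (hInt (a j))) *
          ∏ k ∈ (t.erase i).erase j, hInt (a k) := by
    intro m n
    rw [derivation_prod, map_sum, ← Finset.sum_add_distrib]
    refine Finset.sum_congr rfl fun i _ => ?_
    rw [pderiv_mul, derivation_prod, Finset.mul_sum]
    refine congrArg₂ _ rfl (Finset.sum_congr rfl fun j _ => ?_)
    rw [mul_assoc]
  have h3 : ∑ i ∈ t, diffOp z z' (hInt (a i)) * ∏ j ∈ t.erase i, hInt (a j) =
      ∑ i ∈ t, (∑ m ∈ s, ∑ n ∈ s, coeff₂ m n * pderiv m (pderiv n (hInt (a i)))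
      + ∑ n ∈ s, coeff₁ z z' n * pderiv n (hInt (a i))) * ∏ j ∈ t.erase i, hInt (a j) :=
    Finset.sum_congr rfl fun i hi => by rw [diffOp_eq_sum z z' (hs i hi)]
  have h4 : ∑ i ∈ t, ∑ j ∈ t.erase i,
        symbolInt (a i) (a j) * ∏ k ∈ (t.erase i).erase j, hInt (a k) =
      ∑ i ∈ t, ∑ j ∈ t.erase i, (∑ m ∈ s, ∑ n ∈ s,
        coeff₂ m n * (pderiv n (hInt (a i)) * pderiv m (hInt (a j)))) *
          ∏ k ∈ (t.erase i).erase j, hInt (a k) := by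
    refine Finset.sum_congr rfl fun i hi => Finset.sum_congr rfl fun j hj => ?_
    rw [symbolInt_comm, ← sum_coeff₂_mul_pderiv_hInt _ _ (hs j (Finset.mem_of_mem_erase hj)) (hs i hi)]
    simp only [mul_comm]
  rw [h3, h4, diffOp_eq_sum z z' hs₀]
  simp only [h2]
  simp only [derivation_prod, mul_add, add_mul, Finset.sum_add_distrib, Finset.mul_sum,
    Finset.sum_mul]
  have hcomm : ∀ (u : Finset ι) (g : ℕ+ → ι → MvPolynomial ℕ+ ℂ),
      ∑ n ∈ s, ∑ j ∈ u, g n j = ∑ j ∈ u, ∑ n ∈ s, g n j := fun u g => Finset.sum_comm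
  have hcomm₂ : ∀ (u : ι → Finset ι) (g : ℕ+ → ι → ι → MvPolynomial ℕ+ ℂ),
      ∑ n ∈ s, ∑ i ∈ t, ∑ j ∈ u i, g n i j = ∑ i ∈ t, ∑ j ∈ u i, ∑ n ∈ s, g n i j := by
    intro u g
    rw [hcomm]
    exact Finset.sum_congr rfl fun i _ => hcomm _ _
  simp only [hcomm₂, hcomm t, mul_assoc]
  ring

/-! ### Determinants with modified columns -/

section Determinant

variable {n R : Type*} [Fintype n] [DecidableEq n] [CommRing R]

theorem det_updateCol_eq_sum_perm (A : Matrix n n R) (c : n) (u : n → R) :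
    (A.updateCol c u).det = ∑ σ : Equiv.Perm n, ((Equiv.Perm.sign σ : ℤ) : R) *
      (u (σ c) * ∏ k ∈ Finset.univ.erase c, A (σ k) k) := by
  rw [Matrix.det_apply']
  refine Finset.sum_congr rfl fun σ _ => ?_
  rw [← Finset.mul_prod_erase _ _ (Finset.mem_univ c), Matrix.updateCol_self]
  refine congrArg _ (congrArg _ (Finset.prod_congr rfl fun k hk => ?_))
  rw [Matrix.updateCol_ne (Finset.ne_of_mem_erase hk)]

/-- The alternating sum obtained from the expansion of `det A` by replacing the two factors from
the columns `c` and `d` by a function of their row indices. -/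
def pairSum (A : Matrix n n R) (c d : n) (g : n → n → R) : R :=
  ∑ σ : Equiv.Perm n, ((Equiv.Perm.sign σ : ℤ) : R) *
    (g (σ c) (σ d) * ∏ k ∈ (Finset.univ.erase c).erase d, A (σ k) k)

theorem pairSum_mul (A : Matrix n n R) {c d : n} (hcd : c ≠ d) (u w : n → R) :
    pairSum A c d (fun i j => u i * w j) = ((A.updateCol c u).updateCol d w).det := by
  rw [det_updateCol_eq_sum_perm, pairSum]
  refine Finset.sum_congr rfl fun σ _ => congrArg _ ?_
  rw [← Finset.mul_prod_erase _ _ (Finset.mem_erase.2 ⟨hcd, Finset.mem_univ c⟩),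
    Matrix.updateCol_self, Finset.erase_right_comm, mul_comm (u _), mul_assoc]
  refine congrArg _ (congrArg _ (Finset.prod_congr rfl fun k hk => ?_))
  rw [Matrix.updateCol_ne (Finset.ne_of_mem_erase (Finset.mem_of_mem_erase
    (Finset.erase_right_comm (s := Finset.univ) (a := d) (b := c) ▸ hk)))]

theorem pairSum_add (A : Matrix n n R) (c d : n) (g g' : n → n → R) :
    pairSum A c d (fun i j => g i j + g' i j) = pairSum A c d g + pairSum A c d g' := by
  simp only [pairSum, add_mul, mul_add, Finset.sum_add_distrib]

theorem pairSum_neg (A : Matrix n n R) (c d : n) (g : n → n → R) :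
    pairSum A c d (fun i j => - g i j) = - pairSum A c d g := by
  simp only [pairSum, neg_mul, mul_neg, Finset.sum_neg_distrib]

theorem pairSum_comm (A : Matrix n n R) (c d : n) (g : n → n → R) :
    pairSum A c d g = pairSum A d c (fun i j => g j i) := by
  simp only [pairSum, Finset.erase_right_comm (a := c)]

/-- Replacing `σ` by `σ ∘ (c d)` exchanges the two row indices, leaves the other factors alone and
flips the sign. -/
theorem pairSum_swap (A : Matrix n n R) {c d : n} (hcd : c ≠ d) (g : n → n → R) :
    pairSum A c d (fun i j => g j i) = - pairSum A c d g := by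
  rw [pairSum, pairSum, ← Finset.sum_neg_distrib]
  refine Fintype.sum_equiv (Equiv.mulRight (Equiv.swap c d)) _ _ fun σ => ?_
  simp only [Equiv.coe_mulRight, Equiv.Perm.coe_mul, Function.comp_apply, Equiv.swap_apply_left,
    Equiv.swap_apply_right, Equiv.Perm.sign_mul, Equiv.Perm.sign_swap hcd]
  have h : ∏ k ∈ (Finset.univ.erase c).erase d, A (σ (Equiv.swap c d k)) k =
      ∏ k ∈ (Finset.univ.erase c).erase d, A (σ k) k := by
    refine Finset.prod_congr rfl fun k hk => ?_
    simp only [Finset.mem_erase, Finset.mem_univ, and_true] at hk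
    rw [Equiv.swap_apply_of_ne_of_ne hk.2 hk.1]
  rw [h]
  simp

/-- Both sides equal the trace of `adj(A) B`. This converts changes of columns into changes of rows.
-/
theorem sum_det_updateCol (A B : Matrix n n R) :
    ∑ c, (A.updateCol c fun i => B i c).det = ∑ i, (A.updateRow i (B i)).det := by
  have h1 : ∀ c, (A.updateCol c fun i => B i c).det = ∑ i, A.adjugate c i * B i c := by
    intro c
    rw [← Matrix.cramer_apply, Matrix.cramer_eq_adjugate_mulVec]
    rfl
  have h2 : ∀ i, (A.updateRow i (B i)).det = ∑ c, A.adjugate c i * B i c := by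
    intro i
    rw [← Matrix.det_transpose, ← Matrix.updateCol_transpose, ← Matrix.cramer_apply,
      Matrix.cramer_eq_adjugate_mulVec, ← Matrix.adjugate_transpose]
    rfl
  simp only [h1, h2]
  exact Finset.sum_comm

end Determinant

/-! ### The operator on Jacobi–Trudi determinants -/

section JacobiTrudi

variable {M : ℕ}

/-- The matrix with entries `h_{b_i + c}`. -/
noncomputable def jtMatrix (b : Fin M → ℤ) : Matrix (Fin M) (Fin M) (MvPolynomial ℕ+ ℂ) :=
  Matrix.of fun i c => hInt (b i + (c : ℕ))

theorem jtMatrix_apply (b : Fin M → ℤ) (i c : Fin M) :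
    jtMatrix b i c = hInt (b i + (c : ℕ)) := rfl

/-- The vector with entries `(b_i + c) h_{b_i + c}`. -/
noncomputable def eulerCol (b : Fin M → ℤ) (c : ℤ) : Fin M → MvPolynomial ℕ+ ℂ :=
  fun i => C ((b i + c : ℤ) : ℂ) * hInt (b i + c)

theorem diffOp_det_jtMatrix_eq_pairSum (z z' : ℂ) (b : Fin M → ℤ) :
    diffOp z z' (jtMatrix b).det =
      ∑ c, ((jtMatrix b).updateCol c fun i => diffOp z z' (hInt (b i + (c : ℕ)))).det
      + ∑ c, ∑ d ∈ Finset.univ.erase c,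
        pairSum (jtMatrix b) c d fun i j => symbolInt (b i + (c : ℕ)) (b j + (d : ℕ)) := by
  have hsign : ∀ (σ : Equiv.Perm (Fin M)) (F : MvPolynomial ℕ+ ℂ),
      diffOpLin z z' (((Equiv.Perm.sign σ : ℤ) : MvPolynomial ℕ+ ℂ) * F) =
        ((Equiv.Perm.sign σ : ℤ) : MvPolynomial ℕ+ ℂ) * diffOpLin z z' F := by
    intro σ F
    rw [← zsmul_eq_mul, map_zsmul, zsmul_eq_mul]
  rw [Matrix.det_apply', ← diffOpLin_apply, map_sum]
  simp only [hsign, jtMatrix_apply, diffOpLin_apply]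
  simp only [diffOp_prod_hInt z z' Finset.univ fun c : Fin M => b _ + (c : ℕ), mul_add,
    Finset.sum_add_distrib, det_updateCol_eq_sum_perm, pairSum, Finset.mul_sum, jtMatrix_apply]
  congr 1
  · exact Finset.sum_comm
  · rw [Finset.sum_comm]
    exact Finset.sum_congr rfl fun c _ => Finset.sum_comm

/-- The recurrence produces the factor `(b_i + p) - (b_j + q)`. Its second half changes sign when
the rows are exchanged, which gives the last summand. -/
theorem pairSum_symbolInt_add_one (b : Fin M → ℤ) {c d : Fin M} (hcd : c ≠ d) (p q : ℤ) :
    pairSum (jtMatrix b) c d (fun i j => symbolInt (b i + p) (b j + (q + 1))) =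
      pairSum (jtMatrix b) c d (fun i j => symbolInt (b i + (p + 1)) (b j + q))
      + pairSum (jtMatrix b) c d (fun i j => eulerCol b p i * hInt (b j + q))
      + pairSum (jtMatrix b) c d (fun i j => eulerCol b q i * hInt (b j + p)) := by
  rw [← neg_neg (pairSum (jtMatrix b) c d fun i j => eulerCol b q i * hInt (b j + p)),
    ← pairSum_swap _ hcd, ← pairSum_neg, ← pairSum_add, ← pairSum_add]
  congr 1
  funext i j
  rw [← add_assoc, symbolInt_add_one, ← add_assoc, eulerCol, eulerCol]
  push_cast
  simp only [map_sub, map_add]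
  ring

theorem pairSum_symbolInt_add_natCast (b : Fin M → ℤ) {c d : Fin M} (hcd : c ≠ d) (p : ℤ)
    (k : ℕ) :
    pairSum (jtMatrix b) c d (fun i j => symbolInt (b i + p) (b j + (p + k))) =
      pairSum (jtMatrix b) c d (fun i j => symbolInt (b i + (p + k)) (b j + p))
      + 2 * ∑ e ∈ Finset.range k, pairSum (jtMatrix b) c d
        (fun i j => eulerCol b (p + e) i * hInt (b j + (p + k - 1 - e))) := by
  -- Two independent base points are needed, since the induction step applies the hypothesis at `q +
  -- 1`.
  have key : ∀ (k : ℕ) (p q : ℤ),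
      pairSum (jtMatrix b) c d (fun i j => symbolInt (b i + p) (b j + (q + k))) =
      pairSum (jtMatrix b) c d (fun i j => symbolInt (b i + (p + k)) (b j + q))
      + ∑ e ∈ Finset.range k, pairSum (jtMatrix b) c d
        (fun i j => eulerCol b (p + e) i * hInt (b j + (q + k - 1 - e)))
      + ∑ e ∈ Finset.range k, pairSum (jtMatrix b) c d
        (fun i j => eulerCol b (q + k - 1 - e) i * hInt (b j + (p + e))) := by
    intro k
    induction k with
    | zero => simp
    | succ k ih =>
      intro p q
      have h1 : q + ((k + 1 : ℕ) : ℤ) = q + 1 + k := by push_cast; ring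
      have h2 : p + ((k + 1 : ℕ) : ℤ) = p + k + 1 := by push_cast; ring
      have h3 : q + 1 + (k : ℤ) - 1 - k = q := by ring
      rw [h1, h2, ih, pairSum_symbolInt_add_one b hcd, Finset.sum_range_succ,
        Finset.sum_range_succ, h3]
      ring
  rw [key, two_mul, ← add_assoc]
  -- For `q = p` the two sums agree after reversing the order of summation.
  refine congrArg₂ _ rfl ((Finset.sum_range_reflect _ k).symm.trans
    (Finset.sum_congr rfl fun e he => ?_))
  have he' : e < k := Finset.mem_range.1 he
  have h1 : p + (k : ℤ) - 1 - ((k - 1 - e : ℕ) : ℤ) = p + e := by omega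
  have h2 : p + ((k - 1 - e : ℕ) : ℤ) = p + k - 1 - e := by omega
  rw [h1, h2]

/-- Shifting `d - c` times turns `(c, d)` into `(d, c)`, which is minus the initial pair sum. So
twice the pair sum equals twice a sum of determinants, of which only the last is nonzero. -/
theorem pairSum_symbolInt_of_lt (b : Fin M → ℤ) {c d : Fin M} (hcd : c < d) :
    pairSum (jtMatrix b) c d (fun i j => symbolInt (b i + (c : ℕ)) (b j + (d : ℕ))) =
      - ((jtMatrix b).updateCol d (eulerCol b ((d : ℕ) - 1))).det := by
  obtain ⟨k, hk⟩ : ∃ k : ℕ, (d : ℕ) = c + (k + 1) := ⟨d - c - 1, by omega⟩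
  have h := pairSum_symbolInt_add_natCast b hcd.ne (c : ℕ) (k + 1)
  have hd : ((d : ℕ) : ℤ) = (c : ℕ) + ((k + 1 : ℕ) : ℤ) := by rw [hk]; push_cast; ring
  rw [← hd] at h
  have hswap : pairSum (jtMatrix b) c d (fun i j => symbolInt (b i + (d : ℕ)) (b j + (c : ℕ))) =
      - pairSum (jtMatrix b) c d (fun i j => symbolInt (b i + (c : ℕ)) (b j + (d : ℕ))) := by
    rw [← pairSum_swap _ hcd.ne]
    simp only [symbolInt_comm]
  -- Here column `d` has become the old column `c`; exchanging the two columns restores column `c`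
  -- at the cost of a sign.
  have hlast : pairSum (jtMatrix b) c d
      (fun i j => eulerCol b ((c : ℕ) + (k : ℕ)) i * hInt (b j + ((d : ℕ) - 1 - (k : ℕ)))) =
      - ((jtMatrix b).updateCol d (eulerCol b ((d : ℕ) - 1))).det := by
    have h1 : ((d : ℕ) : ℤ) - 1 - (k : ℕ) = (c : ℕ) := by omega
    have h2 : ((c : ℕ) : ℤ) + (k : ℕ) = (d : ℕ) - 1 := by omega
    have h3 : (jtMatrix b).updateCol c (fun i => hInt (b i + (c : ℕ))) = jtMatrix b :=
      Matrix.updateCol_eq_self _ _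
    rw [h1, h2, ← neg_neg (pairSum _ _ _ _), ← pairSum_swap _ hcd.ne]
    simp only [mul_comm (eulerCol b _ _)]
    rw [pairSum_mul _ hcd.ne, h3]
  -- For these `e`, the new column `d` repeats column `d - 1 - e`, which lies strictly between `c`
  -- and `d`.
  have hzero : ∀ e ∈ Finset.range k, pairSum (jtMatrix b) c d
      (fun i j => eulerCol b ((c : ℕ) + (e : ℕ)) i * hInt (b j + ((d : ℕ) - 1 - (e : ℕ)))) = 0 := by
    intro e he
    have he' : e < k := Finset.mem_range.1 he
    obtain ⟨f, hf⟩ : ∃ f : Fin M, (f : ℕ) = d - 1 - e := ⟨⟨d - 1 - e, by omega⟩, rfl⟩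
    have hfc : f ≠ c := fun h => by subst h; omega
    have hfd : f ≠ d := fun h => by subst h; omega
    rw [pairSum_mul _ hcd.ne]
    refine Matrix.det_zero_of_column_eq hfd fun i => ?_
    rw [Matrix.updateCol_self, Matrix.updateCol_ne hfd, Matrix.updateCol_ne hfc, jtMatrix_apply]
    congr 2
    omega
  rw [Finset.sum_range_succ, Finset.sum_eq_zero hzero, zero_add, hlast, hswap] at h
  have h2 : (2 : MvPolynomial ℕ+ ℂ) ≠ 0 := two_ne_zero
  refine mul_left_cancel₀ h2 ?_
  linear_combination h

/-- The value for `c < d` does not involve `c`, so column `d` occurs `d` times in each of the two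
orders of the pair. -/
theorem sum_pairSum_symbolInt (b : Fin M → ℤ) :
    ∑ c, ∑ d ∈ Finset.univ.erase c,
        pairSum (jtMatrix b) c d (fun i j => symbolInt (b i + (c : ℕ)) (b j + (d : ℕ))) =
      - ∑ d : Fin M, C (2 * ((d : ℕ) : ℂ)) *
        ((jtMatrix b).updateCol d (eulerCol b ((d : ℕ) - 1))).det := by
  have hsplit : ∀ c : Fin M, Finset.univ.erase c = Finset.Iio c ∪ Finset.Ioi c := by
    intro c
    ext d
    simp
  have hdisj : ∀ c : Fin M, Disjoint (Finset.Iio c) (Finset.Ioi c) := by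
    intro c
    rw [Finset.disjoint_left]
    intro d h1 h2
    simp only [Finset.mem_Iio, Finset.mem_Ioi] at h1 h2
    exact absurd h1 h2.asymm
  have hlow : ∀ c : Fin M, ∑ d ∈ Finset.Iio c,
      pairSum (jtMatrix b) c d (fun i j => symbolInt (b i + (c : ℕ)) (b j + (d : ℕ))) =
      - (C ((c : ℕ) : ℂ) * ((jtMatrix b).updateCol c (eulerCol b ((c : ℕ) - 1))).det) := by
    intro c
    have : ∀ d ∈ Finset.Iio c,
        pairSum (jtMatrix b) c d (fun i j => symbolInt (b i + (c : ℕ)) (b j + (d : ℕ))) =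
        - ((jtMatrix b).updateCol c (eulerCol b ((c : ℕ) - 1))).det := by
      intro d hd
      rw [pairSum_comm, ← pairSum_symbolInt_of_lt b (Finset.mem_Iio.1 hd)]
      simp only [symbolInt_comm]
    rw [Finset.sum_congr rfl this, Finset.sum_const, Fin.card_Iio, nsmul_eq_mul]
    simp
  have hhigh : ∑ c, ∑ d ∈ Finset.Ioi c,
      pairSum (jtMatrix b) c d (fun i j => symbolInt (b i + (c : ℕ)) (b j + (d : ℕ))) =
      ∑ d : Fin M, - (C ((d : ℕ) : ℂ) *
        ((jtMatrix b).updateCol d (eulerCol b ((d : ℕ) - 1))).det) := by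
    rw [Finset.sum_comm' (s' := fun d => Finset.Iio d) (t' := Finset.univ) (by simp)]
    refine Finset.sum_congr rfl fun d _ => ?_
    rw [← hlow]
    refine Finset.sum_congr rfl fun c _ => ?_
    rw [pairSum_comm]
    simp only [symbolInt_comm]
  simp only [hsplit, Finset.sum_union (hdisj _), Finset.sum_add_distrib, hhigh, hlow]
  rw [← Finset.sum_add_distrib, ← Finset.sum_neg_distrib]
  refine Finset.sum_congr rfl fun d _ => ?_
  rw [C_mul, map_ofNat]
  ring

/-- The action of the operator on Jacobi–Trudi determinants with arbitrary integral rows. -/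
theorem diffOp_det_jtMatrix (z z' : ℂ) (b : Fin M → ℤ) :
    diffOp z z' (jtMatrix b).det =
      -(C (∑ i, ((b i : ℂ) + (i : ℕ))) * (jtMatrix b).det)
      + ∑ i, C ((z + b i - 1) * (z' + b i - 1)) *
          (jtMatrix (Function.update b i (b i - 1))).det := by
  -- Expansion of `(z + b_i + c - 1)(z' + b_i + c - 1)` around `c = 0`, with the cross terms
  -- arranged so that the `eulerCol` term cancels `sum_pairSum_symbolInt`.
  have hfirst : ∀ c : Fin M,
      ((jtMatrix b).updateCol c fun i => diffOp z z' (hInt (b i + (c : ℕ)))).det =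
      ((jtMatrix b).updateCol c fun i => -(C (b i : ℂ) * jtMatrix b i c)).det
      - C ((c : ℕ) : ℂ) * (jtMatrix b).det
      + ((jtMatrix b).updateCol c fun i => C ((z + b i - 1) * (z' + b i - 1)) *
          hInt (b i - 1 + (c : ℕ))).det
      + C (2 * ((c : ℕ) : ℂ)) *
        ((jtMatrix b).updateCol c (eulerCol b ((c : ℕ) - 1))).det := by
    intro c
    -- The new column `c` repeats column `c - 1`; for `c = 0` the scalar vanishes instead.
    have hshift : C (((c : ℕ) : ℂ) * (z + z' - (c : ℕ))) *
        ((jtMatrix b).updateCol c fun i => hInt (b i - 1 + (c : ℕ))).det = 0 := by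
      rcases Nat.eq_zero_or_pos (c : ℕ) with hc | hc
      · simp [hc]
      · obtain ⟨f, hf⟩ : ∃ f : Fin M, (f : ℕ) = c - 1 := ⟨⟨c - 1, by omega⟩, rfl⟩
        have hfc : f ≠ c := fun h => by subst h; omega
        rw [Matrix.det_zero_of_column_eq hfc fun i => ?_, mul_zero]
        rw [Matrix.updateCol_self, Matrix.updateCol_ne hfc, jtMatrix_apply]
        congr 1
        omega
    have hself : (jtMatrix b).det = ((jtMatrix b).updateCol c fun i => jtMatrix b i c).det := by
      rw [Matrix.updateCol_eq_self]
    conv_rhs => rw [hself]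
    rw [← add_zero (_ + C (2 * ((c : ℕ) : ℂ)) * _), ← hshift, sub_eq_add_neg, ← neg_mul, ← C_neg]
    simp only [← Matrix.det_updateCol_smul, ← Matrix.det_updateCol_add]
    congr 2
    funext i
    simp only [Pi.add_apply, Pi.smul_apply, smul_eq_mul, diffOp_hInt, eulerCol, jtMatrix_apply]
    have h1 : b i + (((c : ℕ) : ℤ) - 1) = b i + (c : ℕ) - 1 := by ring
    have h2 : b i - 1 + ((c : ℕ) : ℤ) = b i + (c : ℕ) - 1 := by ring
    rw [h1, h2]
    push_cast
    simp only [C_mul, C_add, C_sub, C_neg, C_1, map_ofNat]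
    ring
  rw [diffOp_det_jtMatrix_eq_pairSum, sum_pairSum_symbolInt]
  simp only [hfirst, Finset.sum_add_distrib, Finset.sum_sub_distrib]
  have hr1 := sum_det_updateCol (jtMatrix b) (Matrix.of fun i c => -(C (b i : ℂ) * jtMatrix b i c))
  have hr2 := sum_det_updateCol (jtMatrix b) (Matrix.of fun i c =>
    C ((z + b i - 1) * (z' + b i - 1)) * hInt (b i - 1 + (c : ℕ)))
  have hrow1 : ∀ i, ((jtMatrix b).updateRow i
      (Matrix.of (fun i c => -(C (b i : ℂ) * jtMatrix b i c)) i)).det =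
      -(C (b i : ℂ) * (jtMatrix b).det) := by
    intro i
    have : Matrix.of (fun i c => -(C (b i : ℂ) * jtMatrix b i c)) i =
        (-C (b i : ℂ) : MvPolynomial ℕ+ ℂ) • jtMatrix b i := by
      funext c
      simp
    rw [this, Matrix.det_updateRow_smul, Matrix.updateRow_eq_self, neg_mul]
  have hrow2 : ∀ i, ((jtMatrix b).updateRow i (Matrix.of (fun i (c : Fin M) =>
      C ((z + b i - 1) * (z' + b i - 1)) * hInt (b i - 1 + (c : ℕ))) i)).det =
      C ((z + b i - 1) * (z' + b i - 1)) *
        (jtMatrix (Function.update b i (b i - 1))).det := by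
    intro i
    have h1 : Matrix.of (fun i (c : Fin M) =>
        C ((z + b i - 1) * (z' + b i - 1)) * hInt (b i - 1 + (c : ℕ))) i =
        (C ((z + b i - 1) * (z' + b i - 1)) : MvPolynomial ℕ+ ℂ) •
          fun c : Fin M => hInt (b i - 1 + (c : ℕ)) := by
      funext c
      simp
    rw [h1, Matrix.det_updateRow_smul]
    congr 2
    ext j c : 2
    rcases eq_or_ne j i with rfl | hji
    · simp [jtMatrix_apply]
    · simp [jtMatrix_apply, hji]
  simp only [Matrix.of_apply, hrow1] at hr1
  simp only [Matrix.of_apply, hrow2] at hr2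
  rw [hr1, hr2]
  simp only [Finset.sum_neg_distrib, ← Finset.sum_mul, ← map_sum, C_add]
  ring

end JacobiTrudi

/-! ### Corner boxes and row lengths -/

theorem card_eq_sum_rowLen (ν : YoungDiagram) {M : ℕ} (hM : ν.colLen 0 ≤ M) :
    ν.card = ∑ i : Fin M, ν.rowLen i := by
  rw [Fin.sum_univ_eq_sum_range (fun i => ν.rowLen i), YoungDiagram.card,
    Finset.card_eq_sum_card_fiberwise (f := Prod.fst) (t := Finset.range M)]
  · refine Finset.sum_congr rfl fun i _ => ?_
    rw [YoungDiagram.rowLen_eq_card]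
    rfl
  · rintro ⟨i, j⟩ hc
    have h0 : (i, 0) ∈ ν := ν.up_left_mem le_rfl (Nat.zero_le j) hc
    rw [YoungDiagram.mem_iff_lt_colLen] at h0
    simpa using h0.trans_le hM

theorem mem_corners_iff {ν : YoungDiagram} {i j : ℕ} :
    (i, j) ∈ corners ν ↔ ν.rowLen i = j + 1 ∧ ν.rowLen (i + 1) ≤ j := by
  rw [mem_corners, YoungDiagram.mem_cells, YoungDiagram.mem_iff_lt_rowLen]
  constructor
  · rintro ⟨hj, hl⟩
    have hself : ∀ p ∈ ν, p ≠ (i, j) → ¬ (i, j) ≤ p := by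
      intro p hp hne hle
      have : (i, j) ∈ (ν.cells.erase (i, j) : Set (ℕ × ℕ)) :=
        hl hle (by simpa using ⟨hp, hne⟩)
      simp at this
    have h1 : ¬ (i, j + 1) ∈ ν := fun h => hself _ h (by simp) ⟨le_rfl, Nat.le_succ j⟩
    have h2 : ¬ (i + 1, j) ∈ ν := fun h => hself _ h (by simp) ⟨Nat.le_succ i, le_rfl⟩
    rw [YoungDiagram.mem_iff_lt_rowLen] at h1 h2
    omega
  · rintro ⟨h1, h2⟩
    refine ⟨by omega, fun p q hqp hp => ?_⟩
    simp only [Finset.coe_erase, Set.mem_sdiff, Finset.mem_coe, YoungDiagram.mem_cells,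
      Set.mem_singleton_iff] at hp ⊢
    refine ⟨ν.isLowerSet hqp hp.1, ?_⟩
    rintro rfl
    obtain ⟨i', j'⟩ := p
    obtain ⟨hi, hj⟩ : i ≤ i' ∧ j ≤ j' := hqp
    have hlt := YoungDiagram.mem_iff_lt_rowLen.1 hp.1
    rcases hi.lt_or_eq with hi | rfl
    · have := ν.rowLen_anti (i + 1) i' hi
      omega
    · refine hp.2 ?_
      rw [Prod.mk.injEq]
      omega

theorem rowLen_corner {ν : YoungDiagram} (c : {c // c ∈ corners ν}) :
    ν.rowLen c.1.1 = c.1.2 + 1 := by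
  obtain ⟨⟨i, j⟩, hc⟩ := c
  exact (mem_corners_iff.1 hc).1

theorem rowLen_removeCorner (ν : YoungDiagram) (c : {c // c ∈ corners ν}) (i : ℕ) :
    (removeCorner ν c).rowLen i = if i = c.1.1 then ν.rowLen i - 1 else ν.rowLen i := by
  obtain ⟨⟨a, b⟩, hc⟩ := c
  have hc' := mem_corners_iff.1 hc
  refine eq_of_forall_lt_iff fun j => ?_
  rw [← YoungDiagram.mem_iff_lt_rowLen, ← YoungDiagram.mem_cells, removeCorner, Finset.mem_erase,
    YoungDiagram.mem_cells, YoungDiagram.mem_iff_lt_rowLen, Ne, Prod.mk.injEq]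
  dsimp only
  split_ifs with h
  · subst h
    omega
  · tauto

theorem colLen_removeCorner_le (ν : YoungDiagram) (c : {c // c ∈ corners ν}) :
    (removeCorner ν c).colLen 0 ≤ ν.colLen 0 := by
  rw [← rowLen_eq_zero_iff, rowLen_removeCorner, (rowLen_eq_zero_iff ν _).2 le_rfl]
  simp

/-! ### Jacobi–Trudi determinants of Young diagrams -/

/-- The Jacobi–Trudi determinant `det [h_{ν_i - i + j}]` of size `M`. -/
noncomputable def jacobiTrudi (ν : YoungDiagram) (M : ℕ) : MvPolynomial ℕ+ ℂ :=
  (jtMatrix fun i : Fin M => (ν.rowLen i : ℤ) - (i : ℕ)).det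

/-- Lowering row `i` makes it equal to row `i + 1`. If `i` is the last row, then `ν_i = 0` and all
its indices become negative. -/
theorem det_jtMatrix_update_eq_zero {ν : YoungDiagram} {M : ℕ} (hM : ν.colLen 0 ≤ M) (i : Fin M)
    (hi : ν.rowLen (i + 1) = ν.rowLen i) :
    (jtMatrix (Function.update (fun i : Fin M => (ν.rowLen i : ℤ) - (i : ℕ)) i
      ((ν.rowLen i : ℤ) - (i : ℕ) - 1))).det = 0 := by
  by_cases hlt : (i : ℕ) + 1 < M
  · obtain ⟨k, hk⟩ : ∃ k : Fin M, (k : ℕ) = i + 1 := ⟨⟨i + 1, hlt⟩, rfl⟩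
    have hki : k ≠ i := fun h => by subst h; omega
    refine Matrix.det_zero_of_row_eq hki ?_
    funext c
    rw [jtMatrix_apply, jtMatrix_apply, Function.update_self, Function.update_of_ne hki, hk, hi]
    congr 1
    push_cast
    ring
  · have h0 : ν.rowLen i = 0 := by
      rw [← hi, rowLen_eq_zero_iff]
      omega
    refine Matrix.det_eq_zero_of_row_eq_zero i fun c => ?_
    rw [jtMatrix_apply, Function.update_self, h0]
    refine hInt_of_neg ?_
    omega

theorem jacobiTrudi_removeCorner (ν : YoungDiagram) {M : ℕ} (c : {c // c ∈ corners ν})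
    (i : Fin M) (hi : (i : ℕ) = c.1.1) :
    jacobiTrudi (removeCorner ν c) M =
      (jtMatrix (Function.update (fun i : Fin M => (ν.rowLen i : ℤ) - (i : ℕ)) i
        ((ν.rowLen i : ℤ) - (i : ℕ) - 1))).det := by
  rw [jacobiTrudi]
  congr 2
  funext k
  rw [rowLen_removeCorner]
  rcases eq_or_ne k i with rfl | hki
  · have := rowLen_corner c
    rw [Function.update_self, if_pos hi, hi]
    omega
  · rw [Function.update_of_ne hki, if_neg]
    rw [← hi]
    exact fun h => hki (Fin.ext h)

/-- The defining formula of the Laguerre operator, for the differential operator on Jacobi–Trudi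
determinants. -/
theorem diffOp_jacobiTrudi (z z' : ℂ) (ν : YoungDiagram) {M : ℕ} (hM : ν.colLen 0 ≤ M) :
    diffOp z z' (jacobiTrudi ν M) = -(ν.card : ℂ) • jacobiTrudi ν M +
      ∑ c ∈ (corners ν).attach,
        ((z + content c) * (z' + content c)) • jacobiTrudi (removeCorner ν c) M := by
  have hlt : ∀ c : {c // c ∈ corners ν}, c.1.1 < M := by
    intro c
    refine lt_of_lt_of_le ?_ hM
    by_contra hcon
    have := rowLen_corner c
    rw [(rowLen_eq_zero_iff ν _).2 (not_lt.1 hcon)] at this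
    omega
  rw [jacobiTrudi, diffOp_det_jtMatrix]
  congr 1
  · rw [card_eq_sum_rowLen ν hM, smul_eq_C_mul, C_neg, neg_mul]
    congr 3
    push_cast
    simp
  · symm
    refine Finset.sum_of_injOn (fun c => ⟨c.1.1, hlt c⟩) ?_ ?_ ?_ ?_
    · intro c _ c' _ h
      have h1 : c.1.1 = c'.1.1 := congrArg Fin.val h
      have h2 := rowLen_corner c
      have h3 := rowLen_corner c'
      rw [h1, h3] at h2
      exact Subtype.ext (Prod.ext h1 (by omega))
    · intro c _
      simp
    · intro i _ hi
      rw [det_jtMatrix_update_eq_zero hM, mul_zero]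
      by_contra hne
      have hle := ν.rowLen_anti i (i + 1) (Nat.le_succ _)
      have hc : ((i : ℕ), ν.rowLen i - 1) ∈ corners ν := by
        rw [mem_corners_iff]
        omega
      exact hi ⟨⟨_, hc⟩, Finset.mem_coe.2 (Finset.mem_attach _ _), rfl⟩
    · intro c _
      rw [jacobiTrudi_removeCorner ν c ⟨c.1.1, hlt c⟩ rfl, smul_eq_C_mul]
      -- The corner is the last box of its row, so its content is `b_i - 1`.
      have hcont : ∀ w : ℂ, w + content c =
          w + (((ν.rowLen c.1.1 : ℤ) - (c.1.1 : ℕ) : ℤ) : ℂ) - 1 := by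
        intro w
        rw [content, rowLen_corner c]
        push_cast
        ring
      rw [hcont, hcont]

/-- The added last row is `(0, …, 0, 1)`, because `h_n = 0` for `n < 0`. -/
theorem jacobiTrudi_succ {ν : YoungDiagram} {M : ℕ} (hM : ν.colLen 0 ≤ M) :
    jacobiTrudi ν (M + 1) = jacobiTrudi ν M := by
  rw [jacobiTrudi, Matrix.det_succ_row _ (Fin.last M), Finset.sum_eq_single (Fin.last M)]
  · rw [jtMatrix_apply, Fin.val_last, (rowLen_eq_zero_iff ν M).2 hM]
    have h1 : hInt (((0 : ℕ) : ℤ) - M + M) = 1 := by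
      simpa [hVar_zero] using hInt_natCast 0
    rw [h1, ← two_mul, pow_mul, neg_one_sq, one_pow, one_mul, one_mul, jacobiTrudi]
    congr 1
    ext i c : 2
    simp [jtMatrix_apply]
  · intro c _ hc
    have hlt : (c : ℕ) < M := Fin.val_lt_last hc
    rw [jtMatrix_apply, Fin.val_last, (rowLen_eq_zero_iff ν M).2 hM, hInt_of_neg (by omega)]
    simp
  · simp

theorem jacobiTrudi_eq_of_le {ν : YoungDiagram} {M N : ℕ} (hM : ν.colLen 0 ≤ M) (hMN : M ≤ N) :
    jacobiTrudi ν N = jacobiTrudi ν M := by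
  induction N, hMN using Nat.le_induction with
  | base => rfl
  | succ N hN ih => rw [jacobiTrudi_succ (hM.trans hN), ih]

theorem jacobiTrudi_bot (N : ℕ) : jacobiTrudi ⊥ N = 1 := by
  rw [jacobiTrudi_eq_of_le (M := 0) (by simp [YoungDiagram.colLen]) (Nat.zero_le N), jacobiTrudi,
    Matrix.det_fin_zero]

/-! ### The generating function of the complete homogeneous symmetric polynomials -/

section GeneratingFunction

variable {σ : Type*} [Fintype σ] [DecidableEq σ]

theorem mk_hsymm_eq_prod :
    PowerSeries.mk (hsymm σ ℂ) =
      ∏ i : σ, PowerSeries.mk fun n => (X i : MvPolynomial σ ℂ) ^ n := by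
  ext1 d
  rw [PowerSeries.coeff_mk, hsymm, PowerSeries.coeff_prod]
  refine Finset.sum_bij (fun s _ => Multiset.toFinsupp s.1) ?_ ?_ ?_ ?_
  · intro s _
    rw [Finset.mem_finsuppAntidiag]
    refine ⟨?_, Finset.subset_univ _⟩
    exact (Multiset.sum_count_eq_card (s := Finset.univ) (m := s.1) (by simp)).trans s.2
  · intro s _ t _ h
    exact Subtype.ext (Multiset.toFinsupp.injective h)
  · intro f hf
    rw [Finset.mem_finsuppAntidiag] at hf
    refine ⟨⟨Finsupp.toMultiset f, ?_⟩, Finset.mem_univ _, ?_⟩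
    · rw [Finsupp.card_toMultiset, Finsupp.sum_fintype _ _ (by simp)]
      exact hf.1
    · simp
  · intro s _
    rw [Finset.prod_multiset_map_count]
    simp only [PowerSeries.coeff_mk, Multiset.toFinsupp_apply]
    refine Finset.prod_subset (Finset.subset_univ _) fun i _ hi => ?_
    rw [Multiset.mem_toFinset] at hi
    rw [Multiset.count_eq_zero_of_notMem hi, pow_zero]

theorem mk_pow_mul_one_sub {A : Type*} [CommRing A] (a : A) :
    (PowerSeries.mk fun n => a ^ n) * (1 - PowerSeries.C a * PowerSeries.X) = 1 := by
  ext n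
  rw [mul_sub, mul_one, mul_left_comm, map_sub, PowerSeries.coeff_C_mul]
  cases n with
  | zero => simp
  | succ n => simp [PowerSeries.coeff_succ_mul_X, PowerSeries.coeff_one, pow_succ']

/-- The product `∏_{i ≠ j} (1 - x_i t)`. -/
noncomputable def coGenPoly (j : σ) : Polynomial (MvPolynomial σ ℂ) :=
  ∏ i ∈ Finset.univ.erase j, (1 - Polynomial.C (X i) * Polynomial.X)

/-- In `∏_i 1/(1 - x_i t)` all factors but the `j`-th cancel. -/
theorem mk_hsymm_mul_coGenPoly (j : σ) :
    PowerSeries.mk (hsymm σ ℂ) * (coGenPoly j : PowerSeries (MvPolynomial σ ℂ)) =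
      PowerSeries.mk fun n => X j ^ n := by
  have h1 : (coGenPoly j : PowerSeries (MvPolynomial σ ℂ)) =
      ∏ i ∈ Finset.univ.erase j, (1 - PowerSeries.C (X i) * PowerSeries.X) := by
    rw [coGenPoly, ← Polynomial.coeToPowerSeries.ringHom_apply, map_prod]
    simp
  rw [h1, mk_hsymm_eq_prod, ← Finset.mul_prod_erase _ _ (Finset.mem_univ j), mul_assoc,
    ← Finset.prod_mul_distrib]
  simp only [mk_pow_mul_one_sub, Finset.prod_const_one, mul_one]

theorem natDegree_coGenPoly_lt (j : σ) : (coGenPoly j).natDegree < Fintype.card σ := by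
  have h1 : (coGenPoly j).natDegree ≤ ∑ i ∈ Finset.univ.erase j, 1 := by
    refine (Polynomial.natDegree_prod_le _ _).trans (Finset.sum_le_sum fun i _ => ?_)
    refine (Polynomial.natDegree_sub_le _ _).trans (max_le (by simp) ?_)
    exact (Polynomial.natDegree_C_mul_le _ _).trans Polynomial.natDegree_X_le
  have h2 := Fintype.card_pos_iff.2 ⟨j⟩
  rw [Finset.sum_const, Finset.card_erase_of_mem (Finset.mem_univ j), Finset.card_univ] at h1
  simp only [smul_eq_mul, mul_one] at h1
  omega

end GeneratingFunction

/-! ### The Jacobi–Trudi identity -/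

/-- The image of a polynomial in `h_1, h_2, …` in `N` variables. -/
noncomputable def evalN (N : ℕ) : MvPolynomial ℕ+ ℂ →ₐ[ℂ] MvPolynomial (Fin N) ℂ :=
  ((Pi.evalAlgHom ℂ (fun N => MvPolynomial (Fin N) ℂ) N).comp SymC.val).comp evalH

theorem evalN_apply (N : ℕ) (F : MvPolynomial ℕ+ ℂ) : evalN N F = (evalH F).1 N := rfl

theorem evalN_X (N : ℕ) (n : ℕ+) : evalN N (X n) = hsymm (Fin N) ℂ n := by
  rw [evalN_apply, evalH, aeval_X]
  rfl

theorem evalN_hVar (N n : ℕ) : evalN N (hVar n) = hsymm (Fin N) ℂ n := by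
  rw [hVar]
  split_ifs with hn
  · exact evalN_X N _
  · rw [Nat.eq_zero_of_not_pos hn, map_one, hsymm_zero]

theorem X_pow_eq_sum {N : ℕ} (j : Fin N) (n : ℕ) :
    (X j : MvPolynomial (Fin N) ℂ) ^ n =
      ∑ r : Fin N, evalN N (hInt ((n : ℤ) - (r : ℕ))) * (coGenPoly j).coeff r := by
  have h := congrArg (PowerSeries.coeff n) (mk_hsymm_mul_coGenPoly j)
  rw [PowerSeries.coeff_mk, mul_comm, PowerSeries.coeff_mul,
    Finset.Nat.sum_antidiagonal_eq_sum_range_succ_mk] at h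
  rw [← h, Fin.sum_univ_eq_sum_range
    (fun r => evalN N (hInt ((n : ℤ) - (r : ℕ))) * (coGenPoly j).coeff r)]
  have h1 : ∑ k ∈ Finset.range n.succ,
      PowerSeries.coeff k (coGenPoly j : PowerSeries (MvPolynomial (Fin N) ℂ)) *
        PowerSeries.coeff (n - k) (PowerSeries.mk (hsymm (Fin N) ℂ)) =
      ∑ r ∈ Finset.range n.succ, evalN N (hInt ((n : ℤ) - (r : ℕ))) * (coGenPoly j).coeff r := by
    refine Finset.sum_congr rfl fun r hr => ?_
    have hr' : r ≤ n := Nat.lt_succ_iff.1 (Finset.mem_range.1 hr)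
    rw [← Nat.cast_sub hr', hInt_natCast, evalN_hVar, Polynomial.coeff_coe, PowerSeries.coeff_mk,
      mul_comm]
  rw [h1]
  have h2 : ∀ r, N ≤ r → (coGenPoly j).coeff r = 0 := fun r hr =>
    Polynomial.coeff_eq_zero_of_natDegree_lt
      ((natDegree_coGenPoly_lt j).trans_le (by simpa using hr))
  -- The ranges `r ≤ n` and `r < N` differ only in zero terms: either `h_{n-r}` has negative index,
  -- or `r` exceeds the degree of `coGenPoly j`.
  rcases le_total n.succ N with hN | hN
  · refine Finset.sum_subset (by simpa using hN) fun r _ hr => ?_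
    rw [Finset.mem_range, not_lt] at hr
    rw [hInt_of_neg (by omega), map_zero, zero_mul]
  · refine (Finset.sum_subset (by simpa using hN) fun r _ hr => ?_).symm
    rw [Finset.mem_range, not_lt] at hr
    rw [h2 r hr, mul_zero]

/-- The second factor does not depend on `ν`; the empty diagram later identifies it with the
Vandermonde product. -/
theorem alternant_eq_mul (ν : YoungDiagram) (N : ℕ) :
    alternant ν N = evalN N (jacobiTrudi ν N) *
      (Matrix.of fun c j : Fin N => (coGenPoly j).coeff (N - 1 - (c : ℕ))).det := by
  rw [jacobiTrudi, AlgHom.map_det, ← Matrix.det_mul, alternant]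
  congr 1
  ext i j : 1
  rw [Matrix.of_apply, X_pow_eq_sum, Matrix.mul_apply,
    -- With `r = N - 1 - c` the index `ν_i + (N - 1 - i) - r` becomes `ν_i - i + c`.
    ← Equiv.sum_comp (Fin.revPerm : Equiv.Perm (Fin N))]
  refine Finset.sum_congr rfl fun c _ => ?_
  rw [AlgHom.mapMatrix_apply, Matrix.map_apply, jtMatrix_apply, Matrix.of_apply, Fin.revPerm_apply,
    Fin.val_rev]
  have h1 : N - ((c : ℕ) + 1) = N - 1 - c := by omega
  rw [h1]
  congr 3
  have := i.isLt
  have := c.isLt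
  omega

theorem alternant_bot (N : ℕ) : alternant ⊥ N = vandermonde N := by
  have h := Matrix.det_projVandermonde (fun _ : Fin N => (1 : MvPolynomial (Fin N) ℂ)) X
  simp only [one_mul] at h
  rw [vandermonde, ← h, ← Matrix.det_transpose, alternant]
  congr 1
  ext i j : 1
  have h0 : (⊥ : YoungDiagram).rowLen i = 0 := by
    have : ¬ ((i : ℕ), 0) ∈ (⊥ : YoungDiagram) := YoungDiagram.notMem_bot _
    rw [YoungDiagram.mem_iff_lt_rowLen] at this
    omega
  have h1 : N - ((i : ℕ) + 1) = N - 1 - i := by omega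
  simp [Matrix.projVandermonde_apply, h0, Fin.val_rev, h1]

theorem evalN_jacobiTrudi {ν : YoungDiagram} {N : ℕ} (hN : ν.colLen 0 ≤ N) :
    evalN N (jacobiTrudi ν N) = schurPoly ν N := by
  have h := alternant_eq_mul ⊥ N
  rw [jacobiTrudi_bot, map_one, one_mul, alternant_bot] at h
  refine mul_left_cancel₀ (vandermonde_ne_zero N) ?_
  rw [vandermonde_mul_schurPoly hN, alternant_eq_mul ν N, ← h, mul_comm]

theorem SymC_ext_of_le {f g : SymC} (N : ℕ) (h : ∀ M, N ≤ M → f.1 M = g.1 M) : f = g := by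
  refine Subtype.ext (funext fun M => ?_)
  induction k : N - M generalizing M with
  | zero => exact h M (by omega)
  | succ k ih =>
    rw [← f.2.2.1 M, ← g.2.2.1 M, ih (M + 1) (by omega)]

/-- The **Jacobi–Trudi identity**. -/
theorem evalH_jacobiTrudi {ν : YoungDiagram} {M : ℕ} (hM : ν.colLen 0 ≤ M) :
    evalH (jacobiTrudi ν M) = schur ν := by
  refine SymC_ext_of_le M fun N hN => ?_
  rw [← jacobiTrudi_eq_of_le hM hN]
  exact evalN_jacobiTrudi (hM.trans hN)

/-! ### Antisymmetric polynomials are combinations of alternants -/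

section Antisymmetric

variable {N : ℕ}

/-- The alternant `det [x_j ^ e_i]` with arbitrary exponents. -/
noncomputable def alternantOf (e : Fin N → ℕ) : MvPolynomial (Fin N) ℂ :=
  Matrix.det (Matrix.of fun i j : Fin N => (X j : MvPolynomial (Fin N) ℂ) ^ e i)

theorem rename_alternantOf (e : Fin N → ℕ) (σ : Equiv.Perm (Fin N)) :
    rename σ (alternantOf e) = ((Equiv.Perm.sign σ : ℤ) : MvPolynomial (Fin N) ℂ)
      * alternantOf e := by
  rw [alternantOf, ← Matrix.det_permute', AlgHom.map_det]
  congr 1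
  ext i j : 2
  simp

theorem perm_eq_one_of_strictAnti {e p : Fin N → ℕ} (he : StrictAnti e) (hp : StrictAnti p)
    {σ : Equiv.Perm (Fin N)} (h : e ∘ σ = p) : σ = 1 := by
  have hσ : StrictMono σ := by
    intro i j hij
    have : p j < p i := hp hij
    rw [← h] at this
    exact he.lt_iff_gt.1 this
  have h1 : (hσ.orderIsoOfSurjective σ σ.surjective) = OrderIso.refl _ := Subsingleton.elim _ _
  ext i
  exact congrArg (fun f : Fin N ≃o Fin N => ((f i : Fin N) : ℕ)) h1

/-- Two strictly decreasing sequences are permutations of each other only through the identity, so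
at most one term of the determinant contributes. -/
theorem coeff_alternantOf {e : Fin N → ℕ} (he : StrictAnti e) {p : Fin N →₀ ℕ}
    (hp : StrictAnti p) : coeff p (alternantOf e) = if e = p then 1 else 0 := by
  have hmon : ∀ σ : Equiv.Perm (Fin N), ∏ i, (X i : MvPolynomial (Fin N) ℂ) ^ e (σ i) =
      monomial (Finsupp.equivFunOnFinite.symm (e ∘ σ)) 1 := by
    intro σ
    rw [monomial_eq, Finsupp.prod_fintype _ _ (by simp)]
    simp
  have hcoeff : ∀ σ : Equiv.Perm (Fin N),
      coeff p (((Equiv.Perm.sign σ : ℤ) : MvPolynomial (Fin N) ℂ) *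
        ∏ i, (X i : MvPolynomial (Fin N) ℂ) ^ e (σ i)) =
      if e ∘ σ = p then ((Equiv.Perm.sign σ : ℤ) : ℂ) else 0 := by
    intro σ
    have h1 : ((Equiv.Perm.sign σ : ℤ) : MvPolynomial (Fin N) ℂ) =
        C ((Equiv.Perm.sign σ : ℤ) : ℂ) := by simp
    have h2 : Finsupp.equivFunOnFinite.symm (e ∘ σ) = p ↔ e ∘ σ = p := by
      rw [Equiv.symm_apply_eq]
      rfl
    rw [hmon, h1, coeff_C_mul, coeff_monomial]
    simp only [h2]
    split_ifs <;> simp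
  rw [alternantOf, Matrix.det_apply', coeff_sum]
  simp only [Matrix.of_apply, hcoeff]
  rw [Finset.sum_eq_single 1]
  · simp
  · intro σ _ hσ
    exact if_neg fun h => hσ (perm_eq_one_of_strictAnti he hp h)
  · simp

/-- Distinct exponents can be sorted into decreasing order up to sign; an exponent vector with a
repeated entry is fixed by a transposition, so its coefficient equals its own negative. -/
theorem eq_zero_of_antisymmetric {g : MvPolynomial (Fin N) ℂ}
    (hg : ∀ σ : Equiv.Perm (Fin N),
      rename σ g = ((Equiv.Perm.sign σ : ℤ) : MvPolynomial (Fin N) ℂ) * g)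
    (h0 : ∀ p : Fin N →₀ ℕ, StrictAnti p → coeff p g = 0) : g = 0 := by
  have hcoeff : ∀ (σ : Equiv.Perm (Fin N)) (p : Fin N →₀ ℕ),
      coeff p g = ((Equiv.Perm.sign σ : ℤ) : ℂ) * coeff (p.mapDomain σ) g := by
    intro σ p
    have h1 : ((Equiv.Perm.sign σ : ℤ) : MvPolynomial (Fin N) ℂ) =
        C ((Equiv.Perm.sign σ : ℤ) : ℂ) := by simp
    rw [← coeff_rename_mapDomain σ σ.injective g p, hg, h1, coeff_C_mul]
  ext p
  rw [coeff_zero]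
  by_cases hp : Function.Injective p
  · set τ : Equiv.Perm (Fin N) := Fin.revPerm.trans (Tuple.sort p) with hτ
    have hanti : StrictAnti (p ∘ τ) := by
      have hmono : StrictMono (p ∘ Tuple.sort p) :=
        (Tuple.monotone_sort p).strictMono_of_injective (hp.comp (Tuple.sort p).injective)
      intro i j hij
      exact hmono (Fin.rev_lt_rev.2 hij)
    have hmap : ⇑(p.mapDomain τ.symm) = p ∘ τ := by
      funext i
      rw [Finsupp.mapDomain_equiv_apply]
      rfl
    rw [hcoeff τ.symm, h0 _ (by rwa [hmap]), mul_zero]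
  · obtain ⟨i, j, hij, hne⟩ : ∃ i j, p i = p j ∧ i ≠ j := by
      simpa [Function.Injective] using hp
    have hmap : p.mapDomain (Equiv.swap i j) = p := by
      ext k
      rw [Finsupp.mapDomain_equiv_apply, Equiv.symm_swap]
      rcases eq_or_ne k i with rfl | hki
      · rw [Equiv.swap_apply_left, hij]
      rcases eq_or_ne k j with rfl | hkj
      · rw [Equiv.swap_apply_right, hij]
      rw [Equiv.swap_apply_of_ne_of_ne hki hkj]
    have h := hcoeff (Equiv.swap i j) p
    rw [hmap, Equiv.Perm.sign_swap hne] at h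
    simp only [Units.val_neg, Units.val_one, Int.cast_neg, Int.cast_one, neg_mul, one_mul] at h
    exact self_eq_neg.1 h

theorem antisymmetric_eq_sum {g : MvPolynomial (Fin N) ℂ}
    (hg : ∀ σ : Equiv.Perm (Fin N),
      rename σ g = ((Equiv.Perm.sign σ : ℤ) : MvPolynomial (Fin N) ℂ) * g) :
    ∃ s : Finset (Fin N →₀ ℕ), (∀ p ∈ s, p ∈ g.support ∧ StrictAnti p) ∧
      g = ∑ p ∈ s, coeff p g • alternantOf p := by
  classical
  refine ⟨g.support.filter fun p : Fin N →₀ ℕ => StrictAnti p, by simp, ?_⟩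
  rw [← sub_eq_zero]
  refine eq_zero_of_antisymmetric (fun σ => ?_) fun p hp => ?_
  · rw [map_sub, map_sum, hg, mul_sub, Finset.mul_sum]
    simp only [map_smul, rename_alternantOf, mul_smul_comm]
  · rw [coeff_sub, coeff_sum, sub_eq_zero]
    have h1 : ∀ q ∈ g.support.filter fun p : Fin N →₀ ℕ => StrictAnti p,
        coeff p (coeff q g • alternantOf q) = if q = p then coeff p g else 0 := by
      intro q hq
      rw [coeff_smul, coeff_alternantOf (Finset.mem_filter.1 hq).2 hp]
      by_cases h : q = p
      · simp [h]
      · have h' : (q : Fin N → ℕ) ≠ p := fun h' => h (DFunLike.coe_injective h')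
        simp [h, h']
    rw [Finset.sum_congr rfl h1, Finset.sum_ite_eq']
    split_ifs with h
    · rfl
    · by_contra hne
      exact h (Finset.mem_filter.2 ⟨mem_support_iff.2 hne, hp⟩)

theorem add_le_of_strictAnti {e : Fin N → ℕ} (he : StrictAnti e) {i j : Fin N} (hij : i ≤ j) :
    e j + (j - i) ≤ e i := by
  obtain ⟨j, hj⟩ := j
  induction j with
  | zero =>
    have : i = ⟨0, hj⟩ := le_antisymm hij (Nat.zero_le _)
    simp [this]
  | succ j ih =>
    rcases hij.eq_or_lt with rfl | hlt
    · simp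
    · have hlt' : (i : ℕ) < j + 1 := hlt
      have h1 := ih (by omega) (Nat.lt_succ_iff.1 hlt')
      have h2 : e ⟨j + 1, hj⟩ < e ⟨j, by omega⟩ := he (Nat.lt_succ_self j)
      dsimp only at h1 ⊢
      omega

theorem exists_youngDiagram_of_strictAnti {e : Fin N → ℕ} (he : StrictAnti e) :
    ∃ ν : YoungDiagram, ν.colLen 0 ≤ N ∧ ∀ i : Fin N, ν.rowLen i + (N - 1 - (i : ℕ)) = e i := by
  have hsorted : (List.ofFn fun i : Fin N => e i - (N - 1 - (i : ℕ))).SortedGE := by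
    rw [List.sortedGE_ofFn_iff]
    intro i j hij
    have h1 := add_le_of_strictAnti he hij
    have h2 : (i : ℕ) ≤ j := hij
    have := j.isLt
    dsimp only
    omega
  refine ⟨YoungDiagram.ofRowLens _ hsorted, ?_, fun i => ?_⟩
  · by_contra hcon
    have h1 := YoungDiagram.mem_iff_lt_colLen.2 (not_le.1 hcon)
    rw [YoungDiagram.mem_ofRowLens] at h1
    obtain ⟨h2, _⟩ := h1
    simp at h2
  · have h1 := YoungDiagram.rowLen_ofRowLens (hw := hsorted)
      ⟨i, by simp⟩
    have h2 := i.isLt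
    have h3 := add_le_of_strictAnti he (show i ≤ ⟨N - 1, by omega⟩ from Nat.le_sub_one_of_lt h2)
    simp only [Fin.getElem_fin, List.getElem_ofFn] at h1
    dsimp only at h3
    rw [h1]
    simp
    omega

end Antisymmetric

/-! ### Schur functions span the algebra of symmetric functions -/

theorem restrictLast_eq_killCompl (N : ℕ) :
    restrictLast N = killCompl (Fin.castSucc_injective N) := by
  refine MvPolynomial.algHom_ext fun i => ?_
  refine Fin.lastCases ?_ (fun i => ?_) i
  · rw [restrictLast_last, killCompl, aeval_X, dif_neg]
    simp
  · rw [restrictLast_castSucc, ← rename_X, killCompl_rename_app]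

/-- A monomial of degree at most `N` in `N + 1` variables omits one of them. By symmetry that
variable may be taken to be the last, and such monomials survive the restriction. -/
theorem eq_zero_of_restrictLast_eq_zero {N : ℕ} {p : MvPolynomial (Fin (N + 1)) ℂ}
    (hp : p.IsSymmetric) (hdeg : p.totalDegree ≤ N) (h0 : restrictLast N p = 0) : p = 0 := by
  have hlast : ∀ m : Fin (N + 1) →₀ ℕ, m (Fin.last N) = 0 → coeff m p = 0 := by
    intro m hm
    have h1 := congrArg (coeff (m.comapDomain Fin.castSucc (Fin.castSucc_injective N).injOn)) h0
    rw [restrictLast_eq_killCompl, coeff_killCompl, Finsupp.mapDomain_comapDomain _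
      (Fin.castSucc_injective N), coeff_zero] at h1
    · exact h1
    · intro i hi
      refine Fin.lastCases (fun hi => ?_) (fun i _ => ?_) i hi
      · exact absurd hm (Finsupp.mem_support_iff.1 hi)
      · exact ⟨i, rfl⟩
  ext m
  rw [coeff_zero]
  by_contra hne
  obtain ⟨i, hi⟩ : ∃ i, m i = 0 := by
    by_contra hcon
    push Not at hcon
    have h1 := (le_totalDegree (mem_support_iff.2 hne)).trans hdeg
    rw [Finsupp.sum_fintype _ _ (by simp)] at h1
    have h2 : ∑ i : Fin (N + 1), 1 ≤ ∑ i, m i :=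
      Finset.sum_le_sum fun i _ => Nat.one_le_iff_ne_zero.2 (hcon i)
    simp at h2
    omega
  refine hne ?_
  rw [← coeff_rename_mapDomain _ (Equiv.swap i (Fin.last N)).injective, hp]
  refine hlast _ ?_
  rw [Finsupp.mapDomain_equiv_apply, Equiv.symm_swap, Equiv.swap_apply_right, hi]

theorem SymC_eq_zero {f : SymC} {N : ℕ} (hdeg : ∀ M, (f.1 M).totalDegree ≤ N)
    (h0 : f.1 N = 0) : f = 0 := by
  refine SymC_ext_of_le N fun M hM => ?_
  induction M, hM using Nat.le_induction with
  | base => exact h0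
  | succ M hM ih =>
    refine eq_zero_of_restrictLast_eq_zero (f.2.1 _) ((hdeg _).trans hM) ?_
    rw [f.2.2.1, ih]
    rfl

theorem totalDegree_vandermonde (N : ℕ) :
    (vandermonde N).totalDegree = ∑ i : Fin N, (N - 1 - (i : ℕ)) :=
  (vandermonde_isHomogeneous N).totalDegree (vandermonde_ne_zero N)

/-- For `f` of degree at most `d`, the expansion is read off in `d` variables. It lifts to `Sym`
because all terms have degree at most `d`, and such elements are determined by their `d`-variable
component. -/
theorem span_range_schur : Submodule.span ℂ (Set.range schur) = ⊤ := by
  rw [eq_top_iff]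
  rintro f -
  obtain ⟨d, hd⟩ := f.2.2.2
  obtain ⟨s, hs, hg⟩ := antisymmetric_eq_sum (g := vandermonde d * f.1 d) (fun σ => by
    rw [map_mul, rename_vandermonde, f.2.1 d σ, mul_assoc])
  choose! ν hν hrow using fun p (hp : p ∈ s) => exists_youngDiagram_of_strictAnti (hs p hp).2
  have hcard : ∀ p ∈ s, ∀ M, (schurPoly (ν p) M).totalDegree ≤ d := by
    intro p hp M
    refine (totalDegree_schurPoly_le _ _).trans ?_
    -- The exponent `p` has size `|ν| + deg V` and occurs in `V f_d`, of degree at most `deg V + d`;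
    -- hence `|ν| ≤ d`.
    have h1 := le_totalDegree (hs p hp).1
    have h2 := (totalDegree_mul (vandermonde d) (f.1 d)).trans (add_le_add_right (hd d) _)
    rw [Finsupp.sum_fintype _ _ (by simp), ← Finset.sum_congr rfl fun i _ => hrow p hp i,
      Finset.sum_add_distrib] at h1
    rw [totalDegree_vandermonde] at h2
    have h3 : ∑ i : Fin d, (ν p).rowLen i =
        ∑ i ∈ Finset.range ((ν p).colLen 0), (ν p).rowLen i := by
      rw [Fin.sum_univ_eq_sum_range (fun i => (ν p).rowLen i)]
      refine (Finset.sum_subset (by simpa using hν p hp) fun i _ hi => ?_).symm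
      rw [rowLen_eq_zero_iff]
      simpa using hi
    omega
  have hf : f - ∑ p ∈ s, coeff p (vandermonde d * f.1 d) • schur (ν p) = 0 := by
    have hval : ∀ M, (f - ∑ p ∈ s, coeff p (vandermonde d * f.1 d) • schur (ν p)).1 M =
        f.1 M - ∑ p ∈ s, coeff p (vandermonde d * f.1 d) • schurPoly (ν p) M := by
      intro M
      simp [schur]
    refine SymC_eq_zero (N := d) (fun M => ?_) ?_
    · rw [hval]
      refine (totalDegree_sub _ _).trans (max_le (hd M) (totalDegree_finsetSum_le fun p hp => ?_))
      exact (totalDegree_smul_le _ _).trans (hcard p hp M)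
    · rw [hval]
      refine (mul_eq_zero.1 ?_).resolve_left (vandermonde_ne_zero d)
      rw [mul_sub, Finset.mul_sum, sub_eq_zero]
      refine hg.trans (Finset.sum_congr rfl fun p hp => ?_)
      rw [mul_smul_comm, vandermonde_mul_schurPoly (hν p hp), alternant, alternantOf]
      simp only [hrow p hp]
  rw [sub_eq_zero.1 hf]
  exact Submodule.sum_mem _ fun p _ => Submodule.smul_mem _ _ (Submodule.subset_span ⟨_, rfl⟩)

theorem evalH_surjective : Function.Surjective evalH := by
  have h : LinearMap.range evalH.toLinearMap = ⊤ := by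
    rw [eq_top_iff, ← span_range_schur, Submodule.span_le]
    rintro _ ⟨ν, rfl⟩
    exact ⟨jacobiTrudi ν (ν.colLen 0), evalH_jacobiTrudi le_rfl⟩
  exact LinearMap.range_eq_top.1 h

/-! ### Algebraic independence of the complete homogeneous symmetric functions -/

theorem reflect_card_prod_X_sub_C {ι : Type*} (s : Finset ι) (x : ι → ℂ) :
    (∏ i ∈ s, (Polynomial.X - Polynomial.C (x i))).reflect s.card =
      ∏ i ∈ s, (1 - Polynomial.C (x i) * Polynomial.X) := by
  classical
  induction s using Finset.induction_on with
  | empty => simp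
  | insert a s ha ih =>
    rw [Finset.prod_insert ha, Finset.prod_insert ha, Finset.card_insert_of_notMem ha, add_comm,
      Polynomial.reflect_mul _ _ (Polynomial.natDegree_X_sub_C_le _) (by simp), ih,
      Polynomial.reflect_sub, Polynomial.reflect_one_X, Polynomial.reflect_C, pow_one]

/-- The reversed polynomial is monic of degree `N` and splits over `ℂ`; a drop in the degree of `q`
is absorbed by roots `x_i = 0`. -/
theorem exists_prod_one_sub_eq {N : ℕ} {q : Polynomial ℂ} (hq : q.natDegree ≤ N)
    (h0 : q.coeff 0 = 1) :
    ∃ x : Fin N → ℂ, q = ∏ i, (1 - Polynomial.C (x i) * Polynomial.X) := by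
  have hcoeff : (q.reflect N).coeff N = 1 := by
    rw [Polynomial.coeff_reflect, Polynomial.revAt_le le_rfl, Nat.sub_self, h0]
  have hle : (q.reflect N).natDegree ≤ N :=
    Polynomial.natDegree_reflect_le.trans (max_le le_rfl hq)
  have hmonic : (q.reflect N).Monic := Polynomial.monic_of_natDegree_le_of_coeff_eq_one N hle hcoeff
  have hdeg : (q.reflect N).natDegree = N :=
    le_antisymm hle (Polynomial.le_natDegree_of_ne_zero (by simp [hcoeff]))
  have hsplit := IsAlgClosed.splits (q.reflect N)
  have hprod := hsplit.eq_prod_roots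
  have hcard := hsplit.natDegree_eq_card_roots
  rw [hmonic.leadingCoeff, Polynomial.C_1, one_mul] at hprod
  rw [hdeg, ← Multiset.length_toList] at hcard
  rw [← Multiset.coe_toList (q.reflect N).roots, Multiset.map_coe, Multiset.prod_coe] at hprod
  generalize (q.reflect N).roots.toList = l at hprod hcard
  subst hcard
  refine ⟨fun i => l[i], ?_⟩
  have h := reflect_card_prod_X_sub_C (Finset.univ : Finset (Fin l.length)) fun i => l[i]
  rw [← h, Finset.card_univ, Fintype.card_fin]
  have h2 : ∏ i : Fin l.length, (Polynomial.X - Polynomial.C l[i]) = q.reflect l.length := by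
    rw [hprod]
    exact Fin.prod_univ_fun_getElem l fun a => Polynomial.X - Polynomial.C a
  rw [h2, Polynomial.reflect_reflect]

/-- The values of the first `N` complete homogeneous symmetric polynomials in `N` variables can be
prescribed arbitrarily. -/
theorem exists_eval_hsymm_eq (N : ℕ) (c : ℕ → ℂ) (hc : c 0 = 1) :
    ∃ x : Fin N → ℂ, ∀ n ≤ N, eval x (hsymm (Fin N) ℂ n) = c n := by
  set S : PowerSeries ℂ := PowerSeries.mk c
  have hS0 : PowerSeries.constantCoeff S = 1 := by
    rw [← PowerSeries.coeff_zero_eq_constantCoeff_apply, PowerSeries.coeff_mk, hc]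
  have hSS : S⁻¹ * S = 1 := PowerSeries.inv_mul_cancel S (by simp [hS0])
  -- Factoring `q = ∏ (1 - x_i t)` makes `1/q` the generating function of the `h_n(x)`, and `1/q`
  -- agrees with `S` modulo `t^(N+1)`.
  set q := PowerSeries.trunc (N + 1) S⁻¹
  have hq : PowerSeries.X ^ (N + 1) ∣ S⁻¹ - (q : PowerSeries ℂ) := by
    rw [PowerSeries.X_pow_dvd_iff]
    intro m hm
    rw [map_sub, PowerSeries.coeff_coe_trunc_of_lt hm, sub_self]
  obtain ⟨x, hx⟩ := exists_prod_one_sub_eq (N := N) (q := q)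
    (Nat.lt_succ_iff.1 (PowerSeries.natDegree_trunc_lt _ _)) (by
      rw [PowerSeries.coeff_trunc, if_pos (Nat.succ_pos N),
        PowerSeries.coeff_zero_eq_constantCoeff_apply, PowerSeries.constantCoeff_inv, hS0, inv_one])
  refine ⟨x, fun n hn => ?_⟩
  set H : PowerSeries ℂ := PowerSeries.mk fun n => eval x (hsymm (Fin N) ℂ n)
  have hH : H * (q : PowerSeries ℂ) = 1 := by
    have h1 : H = ∏ i, PowerSeries.mk fun n => x i ^ n := by
      have h := congrArg (PowerSeries.map (eval x)) (mk_hsymm_eq_prod (σ := Fin N))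
      rw [map_prod] at h
      refine Eq.trans ?_ (h.trans (Finset.prod_congr rfl fun i _ => ?_)) <;>
      · ext n
        simp [H]
    have h2 : (q : PowerSeries ℂ) = ∏ i, (1 - PowerSeries.C (x i) * PowerSeries.X) := by
      rw [hx, ← Polynomial.coeToPowerSeries.ringHom_apply, map_prod]
      simp
    rw [h1, h2, ← Finset.prod_mul_distrib]
    simp only [mk_pow_mul_one_sub, Finset.prod_const_one]
  have hdvd : PowerSeries.X ^ (N + 1) ∣ H - S := by
    have h1 : H - S = H * S * (S⁻¹ - q) := by
      linear_combination (-H) * hSS + S * hH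
    rw [h1]
    exact hq.mul_left _
  have h := PowerSeries.X_pow_dvd_iff.1 hdvd n (Nat.lt_succ_iff.2 hn)
  rw [map_sub, PowerSeries.coeff_mk, PowerSeries.coeff_mk, sub_eq_zero] at h
  exact h

/-- A relation among the `h_n` would vanish at every point `c`, since a choice of `x` realizes the
values `c_n` for all indices occurring in `F`. -/
theorem evalH_injective : Function.Injective evalH := by
  rw [injective_iff_map_eq_zero]
  intro F hF
  refine MvPolynomial.funext fun c => ?_
  rw [map_zero]
  set N := F.vars.sup fun n => (n : ℕ)
  obtain ⟨x, hx⟩ := exists_eval_hsymm_eq N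
    (fun n => if hn : 0 < n then c ⟨n, hn⟩ else 1) (by simp)
  have h1 : eval x (evalN N F) = 0 := by
    rw [evalN_apply, hF]
    exact map_zero _
  have h2 : eval x (evalN N F) = eval (fun n : ℕ+ => eval x (hsymm (Fin N) ℂ n)) F := by
    have : (eval x).comp (evalN N).toRingHom = eval fun n : ℕ+ => eval x (hsymm (Fin N) ℂ n) := by
      refine MvPolynomial.ringHom_ext (fun a => ?_) fun n => ?_
      · have h3 : evalN N (C a) = C a := (evalN N).commutes a
        simp [h3]
      · simp [evalN_X]
    exact congrArg (fun f => f F) this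
  rw [← h1, h2]
  refine eval₂Hom_congr' rfl (fun n hn _ => ?_) rfl
  rw [hx n (Finset.le_sup (f := fun n : ℕ+ => (n : ℕ)) hn), dif_pos n.pos]
  rfl

/-! ### The Laguerre operator as a differential operator -/

/-- The identification of `ℂ[h_1, h_2, …]` with the algebra of symmetric functions. -/
noncomputable def evalHEquiv : MvPolynomial ℕ+ ℂ ≃ₐ[ℂ] SymC :=
  AlgEquiv.ofBijective evalH ⟨evalH_injective, evalH_surjective⟩

theorem evalHEquiv_apply (F : MvPolynomial ℕ+ ℂ) : evalHEquiv F = evalH F := rfl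

/-- The operator on symmetric functions induced by `diffOp`. -/
noncomputable def diffOpSym (z z' : ℂ) : SymC →ₗ[ℂ] SymC :=
  evalHEquiv.toLinearMap ∘ₗ diffOpLin z z' ∘ₗ evalHEquiv.symm.toLinearMap

theorem diffOpSym_evalH (z z' : ℂ) (F : MvPolynomial ℕ+ ℂ) :
    diffOpSym z z' (evalH F) = evalH (diffOp z z' F) := by
  simp [diffOpSym, ← evalHEquiv_apply]

/-- This also proves existence of the Laguerre operator, without linear independence of the Schur
functions. -/
theorem isLaguerreOperator_diffOpSym (z z' : ℂ) : IsLaguerreOperator z z' (diffOpSym z z') := by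
  intro ν
  rw [← evalH_jacobiTrudi (le_refl (ν.colLen 0)), diffOpSym_evalH,
    diffOp_jacobiTrudi z z' ν le_rfl, map_add, map_sum, map_smul]
  refine congrArg _ (Finset.sum_congr rfl fun c _ => ?_)
  rw [map_smul, evalH_jacobiTrudi (colLen_removeCorner_le ν c)]

theorem IsLaguerreOperator.unique {z z' : ℂ} {D D' : SymC →ₗ[ℂ] SymC}
    (hD : IsLaguerreOperator z z' D) (hD' : IsLaguerreOperator z z' D') : D = D' := by
  refine LinearMap.ext_on span_range_schur ?_
  rintro _ ⟨ν, rfl⟩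
  rw [hD, hD']

end SymFun

theorem corollary4 (z z' : ℂ) :
    Function.Bijective SymFun.evalH ∧
    (∃! D : SymFun.SymC →ₗ[ℂ] SymFun.SymC, SymFun.IsLaguerreOperator z z' D) ∧
    ∀ D : SymFun.SymC →ₗ[ℂ] SymFun.SymC, SymFun.IsLaguerreOperator z z' D →
      ∀ F : MvPolynomial ℕ+ ℂ, D (SymFun.evalH F) = SymFun.evalH (SymFun.diffOp z z' F) := by
  have hL := SymFun.isLaguerreOperator_diffOpSym z z'
  refine ⟨⟨SymFun.evalH_injective, SymFun.evalH_surjective⟩,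
    ⟨_, hL, fun D hD => hD.unique hL⟩, fun D hD F => ?_⟩
  rw [hD.unique hL, SymFun.diffOpSym_evalH]
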